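/- A \emph{2-stage stochastic ILP} with $n$ blocks is the problem $\min\{w^\top x \mid \mathcal{A}x=b,\ L\le x\le U,\ x\in\mathbb{Z}^{s+nt}\}$, where $$\mathcal{A}=\begin{pmatrix}A_1&B_1&0&\cdots&0\\ A_2&0&B_2&\ddots&\vdots\\ \vdots&\vdots&\ddots&\ddots&0\\ A_n&0&\cdots&0&B_n\end{pmatrix},\qquad A_i\in\mathbb{Z}^{r\times s},\ B_i\in\mathbb{Z}^{r\times t},$$ and $b\in\mathbb{Z}^{nr}$, $L,U,w\in\mathbb{Z}^{s+nt}$. Let $\Delta$ be the largest absolute value of an entry of $\mathcal{A}$, and let $|I|$ be the encoding length of the instance $I$ (numbers in binary). Assume the Exponential Time Hypothesis in the following form: there is $\delta_3>0$ such that no algorithm decides 3-SAT in time $O(2^{\delta_3(\ell+m)})$, where $\ell$ is the number of variables and $m$ the number of clauses of the formula. Then there is $\delta>0$ such that no algorithm solves all 2-stage stochastic ILPs in time $2^{\delta\sqrt n}\cdot|I|^{O(1)}$. Moreover there are constants $r,s,t,c\in\mathbb{N}$ such that, for the same $\delta$, no algorithm running in time $2^{\delta\sqrt n}\cdot|I|^{O(1)}$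 decides even just feasibility on the instances with these block dimensions $r,s,t$ for which there is an integer $\ell\ge 2$ with $$\ell^2\le c\,n,\quad n\le c\,\ell^2,\quad \|b\|_\infty,\|L\|_\infty,\|w\|_\infty\le c,\quad \Delta\le c\,\ell^2\log\ell,\quad \|U\|_\infty\le 4^{c\ell^2}.$$ (Algorithms are deterministic multi-stack Turing machines; the running time is the number of steps.) -/

import Mathlib

open Matrix

/-! ### Words, binary encodings, and algorithms -/

/-- Words over the three-letter alphabet of the two bits `some false`, `some true` and the
separator `none`. -/
abbrev Word : Type := List (Option Bool)

/-- A natural number in binary (least significant bit first), followed by a separator. -/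
def encodeNat (k : ℕ) : Word := k.bits.map some ++ [none]

/-- An integer: its sign bit, then its absolute value in binary, then a separator. -/
def encodeInt (z : ℤ) : Word := some (decide (z < 0)) :: encodeNat z.natAbs

/-- The entries of an integer vector, one after the other. -/
def encodeVec {k : ℕ} (v : Fin k → ℤ) : Word := (List.ofFn v).flatMap encodeInt

/-- An algorithm is a deterministic multi-stack Turing machine whose input and output stacks
carry words; its running time is the number of its steps. -/
abbrev Algorithm : Type 1 := Turing.TM2ComputableAux (Option Bool) (Option Bool)

/-- Started on the input word `x`, the algorithm `M` halts with output `y` after at most `T`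
steps. -/
def OutputsWithin (M : Algorithm) (x y : Word) (T : ℝ) : Prop :=
  ∃ k : ℕ, (k : ℝ) ≤ T ∧
    Nonempty (Turing.TM2OutputsInTime M.tm (x.map M.inputAlphabet.symm)
      (some (y.map M.outputAlphabet.symm)) k)

/-- On input `x`, the algorithm `M` decides within `T` steps whether `P` holds. The answer bit is
the first letter of the output: it is `some true` if and only if `P` holds. Whatever follows it
(for instance a witness) is ignored. -/
def DecidesWithin (M : Algorithm) (x : Word) (P : Prop) (T : ℝ) : Prop :=
  ∃ y : Word, OutputsWithin M x y T ∧ (y.head? = some (some true) ↔ P)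

/-! ### 3-SAT and the Exponential Time Hypothesis -/

/-- A 3-CNF formula in `ℓ` variables: a list of clauses, each of three literals. The literal
`(i, true)` is the `i`-th variable, the literal `(i, false)` is its negation. -/
abbrev Formula3 (ℓ : ℕ) : Type := List (Fin 3 → Fin ℓ × Bool)

namespace Formula3

variable {ℓ : ℕ}

/-- Some truth assignment makes at least one literal of every clause true. -/
def Satisfiable (φ : Formula3 ℓ) : Prop :=
  ∃ v : Fin ℓ → Bool, ∀ C ∈ φ, ∃ i : Fin 3, v (C i).1 = (C i).2

/-- A literal: its sign bit, then the index of its variable. -/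
def encodeLiteral (a : Fin ℓ × Bool) : Word := some a.2 :: encodeNat a.1

/-- The number of variables, the number of clauses, and the clauses. -/
def encode (φ : Formula3 ℓ) : Word :=
  encodeNat ℓ ++ encodeNat φ.length ++
    φ.flatMap fun C => encodeLiteral (C 0) ++ encodeLiteral (C 1) ++ encodeLiteral (C 2)

end Formula3

/-- The Exponential Time Hypothesis: for some `δ > 0`, no algorithm decides satisfiability of
3-CNF formulas with `ℓ` variables and `m` clauses in time `O(2 ^ (δ (ℓ + m)))`. -/
def ExponentialTimeHypothesis : Prop :=
  ∃ δ : ℝ, 0 < δ ∧ ¬ ∃ (M : Algorithm) (C : ℝ), ∀ (ℓ : ℕ) (φ : Formula3 ℓ),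
    DecidesWithin M φ.encode φ.Satisfiable
      (C * (2 : ℝ) ^ (δ * ((ℓ : ℝ) + (φ.length : ℝ))))

/-! ### 2-stage stochastic integer linear programs -/

/-- The largest absolute value of an entry of an integer vector (`0` for the empty vector). -/
def infNorm {ι : Type*} [Fintype ι] (v : ι → ℤ) : ℕ := Finset.univ.sup fun i => (v i).natAbs

/-- The data of a 2-stage stochastic ILP with `n` blocks: matrices `A i` of size `r × s` and `B i`
of size `r × t`, the right-hand side `b`, lower bounds `L`, upper bounds `U` and an objective `w`.
Rows are indexed by `(i, a)`, row `a` of block `i`. Columns are indexed by `Sum.inl j` for the `s`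
common variables, and by `Sum.inr (i, j)` for the `t` variables of block `i`. -/
structure TwoStageILP (n r s t : ℕ) where
  A : Fin n → Matrix (Fin r) (Fin s) ℤ
  B : Fin n → Matrix (Fin r) (Fin t) ℤ
  b : Fin n × Fin r → ℤ
  L : Fin s ⊕ Fin n × Fin t → ℤ
  U : Fin s ⊕ Fin n × Fin t → ℤ
  w : Fin s ⊕ Fin n × Fin t → ℤ

/-- A vector in the variables of a 2-stage stochastic ILP: the common variables, then the
variables of the first block, of the second block, and so on. -/
def encodeSolution {n s t : ℕ} (x : Fin s ⊕ Fin n × Fin t → ℤ) : Word :=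
  encodeVec (fun j => x (Sum.inl j)) ++
    (List.finRange n).flatMap fun i => encodeVec fun j => x (Sum.inr (i, j))

namespace TwoStageILP

variable {n r s t : ℕ}

/-- The constraint matrix: the `A i` below each other in the first `s` columns, and the `B i`
along the diagonal beside them. -/
def constraintMatrix (I : TwoStageILP n r s t) :
    Matrix (Fin n × Fin r) (Fin s ⊕ Fin n × Fin t) ℤ :=
  Matrix.of fun p c =>
    match c with
    | Sum.inl j => I.A p.1 p.2 j
    | Sum.inr q => if p.1 = q.1 then I.B p.1 p.2 q.2 else 0

/-- The largest absolute value of an entry of the constraint matrix. -/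
def Delta (I : TwoStageILP n r s t) : ℕ :=
  infNorm fun e : (Fin n × Fin r) × (Fin s ⊕ Fin n × Fin t) => I.constraintMatrix e.1 e.2

/-- `x` satisfies the linear constraints and the bounds. -/
def IsFeasible (I : TwoStageILP n r s t) (x : Fin s ⊕ Fin n × Fin t → ℤ) : Prop :=
  I.constraintMatrix *ᵥ x = I.b ∧ I.L ≤ x ∧ x ≤ I.U

/-- `x` is feasible and minimizes the objective among all feasible vectors. -/
def IsOptimal (I : TwoStageILP n r s t) (x : Fin s ⊕ Fin n × Fin t → ℤ) : Prop :=
  I.IsFeasible x ∧ ∀ y, I.IsFeasible y → I.w ⬝ᵥ x ≤ I.w ⬝ᵥ y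

/-- The encoding of an instance: the dimensions; lower bounds, upper bounds and objective of the
common variables; then, for every block, its rows (of `A i`, of `B i`, and the right-hand side)
and the lower bounds, upper bounds and objective of its variables. -/
def encode (I : TwoStageILP n r s t) : Word :=
  encodeNat n ++ encodeNat r ++ encodeNat s ++ encodeNat t ++
    encodeVec (fun j => I.L (Sum.inl j)) ++
    encodeVec (fun j => I.U (Sum.inl j)) ++
    encodeVec (fun j => I.w (Sum.inl j)) ++
    (List.finRange n).flatMap fun i =>
      ((List.finRange r).flatMap fun a =>
        encodeVec (I.A i a) ++ encodeVec (I.B i a) ++ encodeInt (I.b (i, a))) ++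
      encodeVec (fun j => I.L (Sum.inr (i, j))) ++
      encodeVec (fun j => I.U (Sum.inr (i, j))) ++
      encodeVec (fun j => I.w (Sum.inr (i, j)))

/-- The encoding length `|I|`. -/
def size (I : TwoStageILP n r s t) : ℕ := I.encode.length

/-- On input `I`, the algorithm `M` solves the optimization problem within `T` steps: it answers
`false` if there is no feasible vector, and otherwise answers `true` followed by an optimal
vector. (As all variables are bounded, an optimal vector exists as soon as a feasible one does.) -/
def SolvedWithin (I : TwoStageILP n r s t) (M : Algorithm) (T : ℝ) : Prop :=
  ((¬ ∃ x, I.IsFeasible x) ∧ OutputsWithin M I.encode [some false] T) ∨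
    ∃ x, I.IsOptimal x ∧ OutputsWithin M I.encode (some true :: encodeSolution x) T

/-- The parameter restrictions, with a constant `c`: the number of blocks is of order `ℓ ^ 2`, the
norms of the right-hand side, the lower bounds and the objective are at most `c`, the entries of
the constraint matrix are `O(ℓ ^ 2 log ℓ)`, and the upper bounds are `4 ^ O(ℓ ^ 2)`. -/
structure Restricted (I : TwoStageILP n r s t) (c ℓ : ℕ) : Prop where
  two_le : 2 ≤ ℓ
  sq_le : ℓ ^ 2 ≤ c * n
  le_sq : n ≤ c * ℓ ^ 2
  norm_b : infNorm I.b ≤ c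
  norm_L : infNorm I.L ≤ c
  norm_w : infNorm I.w ≤ c
  delta : (I.Delta : ℝ) ≤ c * ((ℓ : ℝ) ^ 2 * Real.log ℓ)
  norm_U : infNorm I.U ≤ 4 ^ (c * ℓ ^ 2)

end TwoStageILP

/-! A truth assignment is encoded in a single integer. The `i`-th variable gets the `i`-th prime
`p`, and the common variable `X` satisfies `X ≡ 1` or `X ≡ 0` modulo `p` according to its truth
value; by the Chinese remainder theorem every assignment is realized by some `X` below the product
of the primes. Each clause becomes a block of constant size: for each literal a row `X - p q ± z =
const`, in which `z = 1` forces the literal to be true, and a row `z₁ + z₂ + z₃ - slack = 1`. The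
blocks interact only through `X`. Let `N = ℓ + m + 2`. Chebyshev's bound gives `p ≤ 4 N ^ 2`, the
product of the primes is at most `4 ^ (N ^ 2)`, and `N ^ 2` additional zero blocks make `n` of order
`N ^ 2`. Correctness is `satisfiable_of_isFeasible` and `exists_isFeasible`; the parameters are
checked in `restricted_satILP`.

Since `√n ≤ 2 N`, an algorithm with running time `2 ^ (δ / 4 * √n)` times a polynomial in the size
would decide 3-SAT in time `2 ^ (δ / 2 * N)` times a polynomial in `N`, which is `O(2 ^ (δ (ℓ +
m)))` (`exists_algorithm_sat`). A solver of the optimization problem also decides feasibility, so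
this one reduction gives both claims.

The reduction itself has to be a Turing machine. It is written in a small language of stack
programs; compiled code makes at most one transition per loop test (`Exec.reachesIn`), and
`outputsWithin_compose` runs it in front of a given algorithm. All numbers except `4 ^ (N ^ 2)` are
polynomial in `N`, so unary arithmetic and trial division are fast enough. The running time also
bounds the length of the output (`Exec.sum_length_le`). -/

/-! ### Stack programs and their compilation to Turing machines -/

/-- The letters on the stacks of a stack program. -/
abbrev Letter : Type := Option Bool

/-- Structured programs that operate on finitely many stacks of letters. `pop k f` removes the top
of stack `k` and goes on with `f` of it; `loop k c f` keeps removing the top `a` of stack `k` and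
running `f a`, until the stack is empty or the removed letter violates `c`. -/
inductive Prog (K : Type) : Type
  | skip : Prog K
  | push (k : K) (a : Letter) : Prog K
  | seq (p q : Prog K) : Prog K
  | pop (k : K) (f : Option Letter → Prog K) : Prog K
  | loop (k : K) (c : Letter → Bool) (f : Letter → Prog K) : Prog K

namespace Prog

variable {K : Type} [DecidableEq K]

/-- `Exec p s s' t`: run on the stacks `s`, the program `p` ends with the stacks `s'`, using at most
`t` loop tests. -/
inductive Exec : Prog K → (K → Word) → (K → Word) → ℕ → Prop
  | skip (s : K → Word) : Exec .skip s s 0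
  | push (k : K) (a : Letter) (s : K → Word) :
      Exec (.push k a) s (Function.update s k (a :: s k)) 0
  | seq {p q : Prog K} {s s₁ s₂ : K → Word} {t₁ t₂ : ℕ} :
      Exec p s s₁ t₁ → Exec q s₁ s₂ t₂ → Exec (.seq p q) s s₂ (t₁ + t₂)
  | pop {k : K} {f : Option Letter → Prog K} {s s' : K → Word} {t : ℕ} :
      Exec (f (s k).head?) (Function.update s k (s k).tail) s' t → Exec (.pop k f) s s' t
  | loop_nil {k : K} {c : Letter → Bool} {f : Letter → Prog K} {s : K → Word} :
      s k = [] → Exec (.loop k c f) s s 1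
  | loop_exit {k : K} {c : Letter → Bool} {f : Letter → Prog K} {s : K → Word} {a : Letter}
      {l : Word} : s k = a :: l → c a = false →
      Exec (.loop k c f) s (Function.update s k l) 1
  | loop_cons {k : K} {c : Letter → Bool} {f : Letter → Prog K} {s s₁ s₂ : K → Word} {a : Letter}
      {l : Word} {t₁ t₂ : ℕ} : s k = a :: l → c a = true →
      Exec (f a) (Function.update s k l) s₁ t₁ → Exec (.loop k c f) s₁ s₂ t₂ →
      Exec (.loop k c f) s s₂ (t₁ + t₂ + 1)
  | weaken {p : Prog K} {s s' : K → Word} {t t' : ℕ} : Exec p s s' t → t ≤ t' → Exec p s s' t'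

/-- A bound for the number of letters that a program pushes between two loop tests. -/
def weight : Prog K → ℕ
  | .skip => 0
  | .push _ _ => 1
  | .seq p q => p.weight + q.weight
  | .pop _ f => Finset.univ.sup fun o => (f o).weight
  | .loop _ _ f => Finset.univ.sup fun a => (f a).weight

lemma sum_length_update_le [Fintype K] (s : K → Word) (k : K) (l : Word)
    (h : l.length ≤ (s k).length) :
    ∑ j, (Function.update s k l j).length ≤ ∑ j, (s j).length := by
  refine Finset.sum_le_sum fun j _ => ?_
  by_cases hj : j = k
  · subst hj; simpa using h
  · simp [hj]

/-- The total length of the stacks grows at most linearly with the running time. -/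
lemma Exec.sum_length_le [Fintype K] {p : Prog K} {s s' : K → Word} {t : ℕ}
    (h : Exec p s s' t) :
    ∑ j, (s' j).length ≤ ∑ j, (s j).length + p.weight * (t + 1) := by
  induction h with
  | skip => simp
  | push k a s =>
    have : ∀ j, (Function.update s k (a :: s k) j).length
        = (s j).length + if j = k then 1 else 0 := by
      intro j
      by_cases hj : j = k
      · subst hj; simp
      · simp [hj]
    simp [this, Finset.sum_add_distrib, weight]
  | seq _ _ ih₁ ih₂ =>
    simp only [weight]
    nlinarith
  | @pop k f s s' t _ ih =>
    have h1 := sum_length_update_le s k (s k).tail (by simp)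
    have h2 : (f (s k).head?).weight ≤ (Prog.pop k f).weight :=
      Finset.le_sup (f := fun o => (f o).weight) (Finset.mem_univ _)
    nlinarith
  | loop_nil => omega
  | @loop_exit k c f s a l hk _ =>
    have h1 := sum_length_update_le s k l (by simp [hk])
    omega
  | @loop_cons k c f s s₁ s₂ a l t₁ t₂ hk _ _ _ ih₁ ih₂ =>
    have h1 := sum_length_update_le s k l (by simp [hk])
    have h2 : (f a).weight ≤ (Prog.loop k c f).weight :=
      Finset.le_sup (f := fun a => (f a).weight) (Finset.mem_univ _)
    nlinarith
  | weaken _ hle ih =>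
    nlinarith

/-- The labels of the machine code of a program: one for every loop. -/
def Lab : Prog K → Type
  | .skip => Empty
  | .push _ _ => Empty
  | .seq p q => p.Lab ⊕ q.Lab
  | .pop _ f => Σ o, (f o).Lab
  | .loop _ _ f => Option (Σ a, (f a).Lab)

instance finite_lab (p : Prog K) : Finite p.Lab := by
  induction p with
  | skip => exact inferInstanceAs (Finite Empty)
  | push => exact inferInstanceAs (Finite Empty)
  | seq p q ihp ihq => exact inferInstanceAs (Finite (p.Lab ⊕ q.Lab))
  | pop k f ih => exact inferInstanceAs (Finite (Σ o, (f o).Lab))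
  | loop k c f ih => exact inferInstanceAs (Finite (Option (Σ a, (f a).Lab)))

section Compile

open Turing

variable {K₂ : Type} [DecidableEq K₂] {Γ₂ : K₂ → Type} {Λ σ : Type}

/-- The alphabets of a machine whose stacks are those of a program and further ones. -/
abbrev Alph (K : Type) {K₂ : Type} (Γ₂ : K₂ → Type) : K ⊕ K₂ → Type :=
  Sum.elim (fun _ => Letter) Γ₂

/-- Statements of a machine that has the stacks of a program, further stacks, and a register for
one optional letter. -/
abbrev Code (K : Type) {K₂ : Type} (Γ₂ : K₂ → Type) (Λ σ : Type) : Type :=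
  TM2.Stmt (Alph K Γ₂) Λ (Option Letter × σ)

/-- The stacks of a program and further stacks, put together. -/
def join (s : K → Word) (S : ∀ k, List (Γ₂ k)) : ∀ k, List (Alph K Γ₂ k)
  | .inl k => s k
  | .inr k => S k

lemma update_join_inl (s : K → Word) (S : ∀ k, List (Γ₂ k)) (k : K) (l : Word) :
    Function.update (β := fun k => List (Alph K Γ₂ k)) (join s S) (.inl k) l
      = join (Function.update s k l) S := by
  funext j
  rcases j with j | j
  · by_cases h : j = k
    · subst h
      exact (Function.update_self ..).trans (Function.update_self (β := fun _ => Word) ..).symm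
    · exact (Function.update_of_ne (by simpa using h) ..).trans
        (Function.update_of_ne (β := fun _ => Word) h ..).symm
  · exact Function.update_of_ne (by simp) ..

lemma update_join_inr (s : K → Word) (S : ∀ k, List (Γ₂ k)) (k : K₂) (l : List (Γ₂ k)) :
    Function.update (β := fun k => List (Alph K Γ₂ k)) (join s S) (.inr k) l
      = join s (Function.update S k l) := by
  funext j
  rcases j with j | j
  · exact Function.update_of_ne (by simp) ..
  · by_cases h : j = k
    · subst h
      exact (Function.update_self ..).trans (Function.update_self (β := fun k => List (Γ₂ k)) ..).symm
    · exact (Function.update_of_ne (by simpa using h) ..).trans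
        (Function.update_of_ne (β := fun k => List (Γ₂ k)) h ..).symm

/-- Branching on the register. -/
def switch (g : Option Letter → Code K Γ₂ Λ σ) : Code K Γ₂ Λ σ :=
  .branch (fun v => v.1 == none) (g none)
    (.branch (fun v => v.1 == some none) (g (some none))
      (.branch (fun v => v.1 == some (some true)) (g (some (some true))) (g (some (some false)))))

lemma stepAux_switch (g : Option Letter → Code K Γ₂ Λ σ) (v : Option Letter × σ)
    (S : ∀ k, List (Alph K Γ₂ k)) : TM2.stepAux (switch g) v S = TM2.stepAux (g v.1) v S := by
  rcases v with ⟨_ | _ | _ | _, v⟩ <;> rfl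

/-- Pushing a letter on a stack of the program. -/
def pushCode (k : K) (a : Letter) (c : Code K Γ₂ Λ σ) : Code K Γ₂ Λ σ :=
  .push (.inl k) (fun _ => a) c

/-- Branching on the letter removed from a stack of the program. -/
def popCode (k : K) (g : Option Letter → Code K Γ₂ Λ σ) : Code K Γ₂ Λ σ :=
  .pop (.inl k) (fun v o => (o, v.2)) (switch g)

lemma stepAux_pushCode (k : K) (a : Letter) (c : Code K Γ₂ Λ σ) (v : Option Letter × σ)
    (s : K → Word) (S : ∀ k, List (Γ₂ k)) :
    TM2.stepAux (pushCode k a c) v (join s S)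
      = TM2.stepAux c v (join (Function.update s k (a :: s k)) S) :=
  congrArg (TM2.stepAux c v) (update_join_inl s S k (a :: s k))

lemma stepAux_popCode (k : K) (g : Option Letter → Code K Γ₂ Λ σ) (v : Option Letter × σ)
    (s : K → Word) (S : ∀ k, List (Γ₂ k)) :
    TM2.stepAux (popCode k g) v (join s S)
      = TM2.stepAux (g (s k).head?) ((s k).head?, v.2)
        (join (Function.update s k (s k).tail) S) :=
  (congrArg (TM2.stepAux (switch g) ((s k).head?, v.2)) (update_join_inl s S k (s k).tail)).trans
    (stepAux_switch ..)

/-- The machine code of a program up to its first loop test, followed by the code `c`. The map `e`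
embeds the labels of the program into those of the machine. -/
def head : (p : Prog K) → (p.Lab → Λ) → Code K Γ₂ Λ σ → Code K Γ₂ Λ σ
  | .skip, _, c => c
  | .push k a, _, c => pushCode k a c
  -- Continuation-passing style: the head of `q` is what follows `p`, so sequencing costs no
  -- transition of its own.
  | .seq p q, e, c => p.head (fun l => e (.inl l)) (q.head (fun l => e (.inr l)) c)
  | .pop k f, e, c => popCode k fun o => (f o).head (fun l => e ⟨o, l⟩) c
  | .loop _ _ _, e, _ => .goto fun _ => e none

/-- The machine code at the labels of a program. -/
def code : (p : Prog K) → (p.Lab → Λ) → Code K Γ₂ Λ σ → p.Lab → Code K Γ₂ Λ σ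
  | .seq p q, e, c, .inl l => p.code (fun l => e (.inl l)) (q.head (fun l => e (.inr l)) c) l
  | .seq _ q, e, c, .inr l => q.code (fun l => e (.inr l)) c l
  | .pop _ f, e, c, ⟨o, l⟩ => (f o).code (fun l => e ⟨o, l⟩) c l
  | .loop k d f, e, c, none => popCode k fun o => match o with
      | none => c
      | some a => if d a then (f a).head (fun l => e (some ⟨a, l⟩)) (.goto fun _ => e none) else c
  | .loop _ _ f, e, _, some ⟨a, l⟩ =>
      (f a).code (fun l => e (some ⟨a, l⟩)) (.goto fun _ => e none) l

/-- `b` is reached from `a` after exactly `n` transitions. -/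
def ReachesIn {α : Type*} (f : α → Option α) (n : ℕ) (a b : α) : Prop :=
  (flip bind f)^[n] (some a) = some b

lemma ReachesIn.refl {α : Type*} (f : α → Option α) (a : α) : ReachesIn f 0 a a := rfl

lemma ReachesIn.trans {α : Type*} {f : α → Option α} {n m : ℕ} {a b c : α}
    (h₁ : ReachesIn f n a b) (h₂ : ReachesIn f m b c) : ReachesIn f (n + m) a c := by
  unfold ReachesIn at *
  rw [add_comm, Function.iterate_add_apply, h₁, h₂]

lemma ReachesIn.single {α : Type*} {f : α → Option α} {a b : α} (h : f a = some b) :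
    ReachesIn f 1 a b := h

/-- The machine code of a program simulates it, one transition for every loop test. -/
theorem Exec.reachesIn {p : Prog K} {s s' : K → Word} {t : ℕ} (h : Exec p s s' t)
    (m : Λ → Code K Γ₂ Λ σ) (e : p.Lab → Λ) (c : Code K Γ₂ Λ σ)
    (hm : ∀ l, m (e l) = p.code e c l) (S : ∀ k, List (Γ₂ k)) (o : Option Letter) (v : σ) :
    ∃ o' : Option Letter, ∃ n ≤ t, ReachesIn (TM2.step m)
      n (TM2.stepAux (p.head e c) (o, v) (join s S)) (TM2.stepAux c (o', v) (join s' S)) := by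
  -- The continuation has to vary: the first half of a sequence continues with the head of the
  -- second, and a loop body with the jump back to its loop.
  induction h generalizing c o with
  | skip s => exact ⟨o, 0, le_rfl, rfl⟩
  | push k a s =>
    refine ⟨o, 0, le_rfl, ?_⟩
    rw [head, stepAux_pushCode]
    rfl
  | seq _ _ ih₁ ih₂ =>
    obtain ⟨o₁, n₁, hn₁, h₁⟩ := ih₁ (fun l => e (.inl l)) (head _ (fun l => e (.inr l)) c)
      (fun l => hm (.inl l)) o
    obtain ⟨o₂, n₂, hn₂, h₂⟩ := ih₂ (fun l => e (.inr l)) c (fun l => hm (.inr l)) o₁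
    exact ⟨o₂, n₁ + n₂, by omega, h₁.trans h₂⟩
  | @pop k f s s' t _ ih =>
    obtain ⟨o₁, n₁, hn₁, h₁⟩ := ih (fun l => e ⟨_, l⟩) c (fun l => hm ⟨_, l⟩) (s k).head?
    refine ⟨o₁, n₁, hn₁, ?_⟩
    rw [head, stepAux_popCode]
    exact h₁
  | @loop_nil k d f s hk =>
    refine ⟨none, 1, le_rfl, .single ?_⟩
    simp only [head, TM2.stepAux, TM2.step, hm none, code, stepAux_popCode, hk]
    rw [List.tail_nil, ← hk, Function.update_eq_self]
    simp [hk]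
  | @loop_exit k d f s a l hk hd =>
    refine ⟨some a, 1, le_rfl, .single ?_⟩
    simp [head, hm none, code, stepAux_popCode, hk, hd]
  | @loop_cons k d f s s₁ s₂ a l t₁ t₂ hk hd _ _ ih₁ ih₂ =>
    obtain ⟨o₁, n₁, hn₁, h₁⟩ := ih₁ (fun l => e (some ⟨a, l⟩)) (.goto fun _ => e none)
      (fun l => hm (some ⟨a, l⟩)) (some a)
    obtain ⟨o₂, n₂, hn₂, h₂⟩ := ih₂ e c hm o₁
    refine ⟨o₂, 1 + n₁ + n₂, by omega, (ReachesIn.trans (.single ?_) h₁).trans h₂⟩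
    simp [head, hm none, code, stepAux_popCode, hk, hd]
  | weaken _ hle ih =>
    obtain ⟨o₁, n₁, hn₁, h₁⟩ := ih e c hm o
    exact ⟨o₁, n₁, hn₁.trans hle, h₁⟩

end Compile

end Prog

/-! ### Running a program in front of an algorithm -/

namespace Prog

open Turing

variable {K : Type} [DecidableEq K]

section Lift

variable {K₂ : Type} [DecidableEq K₂] {Γ₂ : K₂ → Type} {Λ₂ Λ σ : Type}

/-- The code of a machine, as code of a machine with further stacks and a register. -/
def lift (f : Λ₂ → Λ) : TM2.Stmt Γ₂ Λ₂ σ → Code K Γ₂ Λ σ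
  | .push k g q => .push (.inr k) (fun v => g v.2) (lift f q)
  | .peek k g q => .peek (.inr k) (fun v o => (v.1, g v.2 o)) (lift f q)
  | .pop k g q => .pop (.inr k) (fun v o => (v.1, g v.2 o)) (lift f q)
  | .load g q => .load (fun v => (v.1, g v.2)) (lift f q)
  | .branch g q₁ q₂ => .branch (fun v => g v.2) (lift f q₁) (lift f q₂)
  | .goto g => .goto fun v => f (g v.2)
  | .halt => .halt

/-- The configuration of a machine, as one of a machine with further stacks and a register. -/
def liftCfg (f : Λ₂ → Λ) (c : TM2.Cfg Γ₂ Λ₂ σ) : TM2.Cfg (Alph K Γ₂) Λ (Option Letter × σ) :=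
  ⟨c.l.map f, (none, c.var), join (fun _ => []) c.stk⟩

/-- Lifted code neither reads nor writes the register and the stacks of the program, so these stay
`none` and empty, and the simulation is step for step. -/
lemma stepAux_lift (f : Λ₂ → Λ) (q : TM2.Stmt Γ₂ Λ₂ σ) (v : σ) (S : ∀ k, List (Γ₂ k)) :
    TM2.stepAux (lift (K := K) f q) (none, v) (join (fun _ => []) S)
      = liftCfg f (TM2.stepAux q v S) := by
  induction q generalizing v S with
  | push k g q ih =>
    exact (congrArg (TM2.stepAux (lift f q) (none, v))
      (update_join_inr (fun _ => []) S k (g v :: S k))).trans (ih ..)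
  | peek k g q ih => exact ih ..
  | pop k g q ih =>
    exact (congrArg (TM2.stepAux (lift f q) (none, g v (S k).head?))
      (update_join_inr (fun _ => []) S k (S k).tail)).trans (ih ..)
  | load g q ih => exact ih ..
  | branch g q₁ q₂ ih₁ ih₂ =>
    simp only [lift, TM2.stepAux]
    cases g v
    · exact ih₂ ..
    · exact ih₁ ..
  | goto g => rfl
  | halt => rfl

lemma iterate_step_liftCfg (f : Λ₂ → Λ) (m₂ : Λ₂ → TM2.Stmt Γ₂ Λ₂ σ) (m : Λ → Code K Γ₂ Λ σ)
    (hm : ∀ l, m (f l) = lift f (m₂ l)) (n : ℕ) (c : Option (TM2.Cfg Γ₂ Λ₂ σ)) :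
    (flip bind (TM2.step m))^[n] (c.map (liftCfg f))
      = ((flip bind (TM2.step m₂))^[n] c).map (liftCfg f) := by
  induction n generalizing c with
  | zero => rfl
  | succ n ih =>
    rw [Function.iterate_succ_apply, Function.iterate_succ_apply, ← ih]
    congr 1
    rcases c with _ | ⟨_ | l, v, S⟩
    · rfl
    · rfl
    · change some (TM2.stepAux (m (f l)) _ _) = some _
      rw [hm, stepAux_lift]

end Lift

section Compose

/-- The labels of `compose`: the start, the transfer of the result, the labels of the program, and
those of the algorithm. -/
abbrev ComposeLab (p : Prog K) (M : Algorithm) : Type := Option (Option p.Lab) ⊕ M.tm.Λ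

/-- The code that moves the output of the program to the input stack of the algorithm. -/
def transfer (p : Prog K) (out : K) (M : Algorithm) :
    Code K M.tm.Γ (ComposeLab p M) M.tm.σ :=
  popCode out fun
    | none => .goto fun _ => .inr M.tm.main
    | some a => .push (.inr M.tm.k₀) (fun _ => M.inputAlphabet.symm a)
        (.goto fun _ => .inl (some none))

/-- The code of `compose`. -/
def composeCode (p : Prog K) (out : K) (M : Algorithm) :
    ComposeLab p M → Code K M.tm.Γ (ComposeLab p M) M.tm.σ
  | .inl none => p.head (fun l => .inl (some (some l))) (.goto fun _ => .inl (some none))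
  | .inl (some none) => transfer p out M
  | .inl (some (some l)) =>
      p.code (fun l => .inl (some (some l))) (.goto fun _ => .inl (some none)) l
  | .inr l => lift .inr (M.tm.m l)

/-- The algorithm that runs a program with input stack `inp` and output stack `out`, and then the
algorithm `M` on its output. -/
noncomputable def compose [Fintype K] (p : Prog K) (inp out : K) (M : Algorithm) : Algorithm :=
  letI := M.tm.kFin
  letI := M.tm.ΛFin
  letI := M.tm.σFin
  letI : Fintype p.Lab := Fintype.ofFinite _
  { tm :=
      { K := K ⊕ M.tm.K
        k₀ := .inl inp
        k₁ := .inr M.tm.k₁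
        Γ := Alph K M.tm.Γ
        Λ := ComposeLab p M
        main := .inl none
        σ := Option Letter × M.tm.σ
        initialState := (none, M.tm.initialState)
        Γk₀Fin := inferInstanceAs (Fintype Letter)
        m := composeCode p out M }
    inputAlphabet := Equiv.refl _
    outputAlphabet := M.outputAlphabet }

/-- The stacks of which only `k` is not empty. -/
def only (k : K) (x : Word) : K → Word := Function.update (fun _ => []) k x

/-- Each transition moves one letter; a last one finds the stack empty and thereby resets the
register to `none`, as `liftCfg` requires. The transfer reverses the word, which is why programs
leave their output with its last letter on top. -/
lemma reachesIn_transfer (p : Prog K) (out : K) (M : Algorithm) (y : Word)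
    (S : ∀ k, List (M.tm.Γ k)) (o : Option Letter) (v : M.tm.σ) :
    ReachesIn (TM2.step (composeCode p out M)) (y.length + 1)
      ⟨some (.inl (some none)), (o, v), join (only out y) S⟩
      ⟨some (.inr M.tm.main), (none, v), join (fun _ => []) (Function.update S M.tm.k₀
        (y.reverse.map M.inputAlphabet.symm ++ S M.tm.k₀))⟩ := by
  induction y generalizing S o with
  | nil =>
    refine .single ?_
    simp only [TM2.step, composeCode, transfer, stepAux_popCode]
    simp [only, TM2.stepAux]
  | cons a y ih =>
    rw [List.length_cons, add_comm]
    refine .trans (.single (b := ⟨some (.inl (some none)), (some a, v), join (only out y)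
      (Function.update S M.tm.k₀ (M.inputAlphabet.symm a :: S M.tm.k₀))⟩) ?_) ?_
    · simp only [TM2.step, composeCode, transfer, stepAux_popCode]
      have h : Function.update (only out (a :: y)) out (only out (a :: y) out).tail
          = only out y := by simp [only]
      have h' : (only out (a :: y) out).head? = some a := by simp [only]
      rw [h, h']
      have := update_join_inr (only out y) S M.tm.k₀ (M.inputAlphabet.symm a :: S M.tm.k₀)
      simp only [TM2.stepAux]
      exact congrArg some (congrArg (TM2.Cfg.mk _ _) this)
    · convert ih (Function.update S M.tm.k₀ (M.inputAlphabet.symm a :: S M.tm.k₀)) (some a)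
        using 3
      simp

lemma initList_stk_self (tm : FinTM2) (l : List (tm.Γ tm.k₀)) : (initList tm l).stk tm.k₀ = l := by
  simp [initList]

lemma initList_stk_of_ne (tm : FinTM2) (l : List (tm.Γ tm.k₀)) {k : tm.K} (h : k ≠ tm.k₀) :
    (initList tm l).stk k = [] :=
  dif_neg h

lemma haltList_stk_self (tm : FinTM2) (l : List (tm.Γ tm.k₁)) : (haltList tm l).stk tm.k₁ = l := by
  simp [haltList]

lemma haltList_stk_of_ne (tm : FinTM2) (l : List (tm.Γ tm.k₁)) {k : tm.K} (h : k ≠ tm.k₁) :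
    (haltList tm l).stk k = [] :=
  dif_neg h

/-- The composed algorithm gives the output of the second one, in the sum of the running times and
the time to transfer the intermediate result. -/
theorem outputsWithin_compose [Fintype K] {p : Prog K} {inp out : K} {x y : Word} {t : ℕ}
    (hp : Exec p (only inp x) (only out y.reverse) t) {M : Algorithm} {z : Word} {T : ℝ}
    (hM : OutputsWithin M y z T) :
    OutputsWithin (compose p inp out M) x z ((t : ℝ) + y.length + 2 + T) := by
  obtain ⟨k, hk, ⟨⟨⟨n, hn⟩, hnk⟩⟩⟩ := hM
  obtain ⟨o, n₁, hn₁, h₁⟩ := hp.reachesIn (composeCode p out M) (fun l => .inl (some (some l)))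
    (.goto fun _ => .inl (some none)) (fun l => rfl) (fun _ => []) none M.tm.initialState
  have h₂ := reachesIn_transfer p out M y.reverse (fun _ => []) o M.tm.initialState
  have h₃ := iterate_step_liftCfg (K := K) Sum.inr M.tm.m (composeCode p out M) (fun l => rfl) n
    (some (initList M.tm (y.map M.inputAlphabet.symm)))
  have h₀ : ReachesIn (TM2.step (composeCode p out M)) 1
      ⟨some (.inl none), (none, M.tm.initialState), join (only inp x) (fun _ => [])⟩ _ :=
    .single rfl
  have h := (h₀.trans h₁).trans h₂
  -- The `2` counts the transition out of the start label and the one that finds the output stack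
  -- empty.
  refine ⟨t + y.length + 2 + k, by push_cast; linarith, ⟨⟨⟨n + (1 + n₁ + (y.reverse.length + 1)),
    ?_⟩, ?_⟩⟩⟩
  · rw [Function.iterate_add_apply]
    -- The output relation compares whole configurations, so the initial one, the one at the
    -- handover to `M` and the halting one must agree on every stack and on the internal state.
    have e₁ : initList (compose p inp out M).tm (x.map (compose p inp out M).inputAlphabet.symm)
        = ⟨some (.inl none), (none, M.tm.initialState), join (only inp x) (fun _ => [])⟩ := by
      refine congrArg (TM2.Cfg.mk _ _) (funext fun j => ?_)
      rcases j with j | j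
      · by_cases hj : j = inp
        · subst hj
          have hx : only j x j = x := Function.update_self ..
          exact (initList_stk_self (compose p j out M).tm _).trans ((List.map_id x).trans hx.symm)
        · have hx : only inp x j = [] := Function.update_of_ne hj ..
          exact (dif_neg fun h => hj (Sum.inl.inj h)).trans hx.symm
      · exact dif_neg Sum.inr_ne_inl
    have e₂ : (⟨some (.inr M.tm.main), (none, M.tm.initialState), join (fun _ => [])
        (Function.update (fun _ => []) M.tm.k₀
        (y.reverse.reverse.map M.inputAlphabet.symm ++ []))⟩ :
          TM2.Cfg (Alph K M.tm.Γ) (ComposeLab p M) (Option Letter × M.tm.σ))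
        = liftCfg Sum.inr (initList M.tm (y.map M.inputAlphabet.symm)) := by
      rw [List.reverse_reverse, List.append_nil]
      refine congrArg (fun S => TM2.Cfg.mk _ _ (join _ S)) (funext fun j => ?_)
      by_cases hj : j = M.tm.k₀
      · subst hj
        exact (Function.update_self ..).trans (initList_stk_self ..).symm
      · exact (Function.update_of_ne hj ..).trans (initList_stk_of_ne _ _ hj).symm
    have e₃ : haltList (compose p inp out M).tm (z.map (compose p inp out M).outputAlphabet.symm)
        = liftCfg Sum.inr (haltList M.tm (z.map M.outputAlphabet.symm)) := by
      refine congrArg (TM2.Cfg.mk _ _) (funext fun j => ?_)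
      rcases j with j | j
      · exact dif_neg Sum.inl_ne_inr
      · by_cases hj : j = M.tm.k₁
        · subst hj
          exact (haltList_stk_self (compose p inp out M).tm _).trans
            (haltList_stk_self M.tm _).symm
        · exact (dif_neg fun h => hj (Sum.inr.inj h)).trans (haltList_stk_of_ne _ _ hj).symm
    rw [e₁]
    refine (congrArg _ (Eq.trans h (congrArg some e₂))).trans ?_
    refine h₃.trans ((congrArg _ hn).trans ?_)
    exact congrArg some e₃.symm
  · have hnk' : n ≤ k := hnk
    simp only [List.length_reverse]
    omega

end Compose

end Prog

/-! ### Subroutines on named stacks -/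

/-- The stacks of the reduction. -/
inductive Stk
  | inp | out | dig | u | v | w | c | g | e | f | h | fl | bin | nn | mm | sq | cnt
  deriving DecidableEq

instance : Fintype Stk where
  elems := {.inp, .out, .dig, .u, .v, .w, .c, .g, .e, .f, .h, .fl, .bin, .nn, .mm, .sq, .cnt}
  complete k := by cases k <;> decide

/-- The contents of the stacks of the reduction. -/
structure St where
  inp : Word := []
  out : Word := []
  dig : Word := []
  u : Word := []
  v : Word := []
  w : Word := []
  c : Word := []
  g : Word := []
  e : Word := []
  f : Word := []
  h : Word := []
  fl : Word := []
  bin : Word := []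
  nn : Word := []
  mm : Word := []
  sq : Word := []
  cnt : Word := []

namespace St

/-- The contents of a stack. -/
def get (s : St) : Stk → Word
  | .inp => s.inp
  | .out => s.out
  | .dig => s.dig
  | .u => s.u
  | .v => s.v
  | .w => s.w
  | .c => s.c
  | .g => s.g
  | .e => s.e
  | .f => s.f
  | .h => s.h
  | .fl => s.fl
  | .bin => s.bin
  | .nn => s.nn
  | .mm => s.mm
  | .sq => s.sq
  | .cnt => s.cnt

/-- Replace the contents of a stack. -/
def set (s : St) (k : Stk) (x : Word) : St :=
  match k with
  | .inp => { s with inp := x }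
  | .out => { s with out := x }
  | .dig => { s with dig := x }
  | .u => { s with u := x }
  | .v => { s with v := x }
  | .w => { s with w := x }
  | .c => { s with c := x }
  | .g => { s with g := x }
  | .e => { s with e := x }
  | .f => { s with f := x }
  | .h => { s with h := x }
  | .fl => { s with fl := x }
  | .bin => { s with bin := x }
  | .nn => { s with nn := x }
  | .mm => { s with mm := x }
  | .sq => { s with sq := x }
  | .cnt => { s with cnt := x }

attribute [simp] get.eq_1 set.eq_1 get.eq_2 set.eq_2 get.eq_3 set.eq_3 get.eq_4
  set.eq_4 get.eq_5 set.eq_5 get.eq_6 set.eq_6 get.eq_7 set.eq_7 get.eq_8 set.eq_8 get.eq_9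
  set.eq_9 get.eq_10 set.eq_10 get.eq_11 set.eq_11 get.eq_12 set.eq_12 get.eq_13 set.eq_13 get.eq_14
  set.eq_14 get.eq_15 set.eq_15 get.eq_16 set.eq_16 get.eq_17 set.eq_17

lemma ext_get {s₁ s₂ : St} (h : s₁.get = s₂.get) : s₁ = s₂ := by
  rcases s₁ with ⟨⟩
  rcases s₂ with ⟨⟩
  have := fun k => congrFun h k
  simp only [St.mk.injEq]
  exact ⟨this .inp, this .out, this .dig, this .u, this .v, this .w, this .c, this .g, this .e,
    this .f, this .h, this .fl, this .bin, this .nn, this .mm, this .sq, this .cnt⟩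

lemma get_set (s : St) (k : Stk) (x : Word) : (s.set k x).get = Function.update s.get k x := by
  funext j
  by_cases h : j = k
  · subst h
    rw [Function.update_self]
    cases j <;> rfl
  · rw [Function.update_of_ne h]
    cases k <;> cases j <;> first | rfl | exact absurd rfl h

lemma get_set_self (s : St) (k : Stk) (x : Word) : (s.set k x).get k = x := by
  rw [get_set, Function.update_self]

end St

namespace Prog

/-- `Exec` for the stacks of the reduction. -/
def Run (p : Prog Stk) (s s' : St) (t : ℕ) : Prop := Exec p s.get s'.get t

namespace Run

variable {p q : Prog Stk} {s s' s₁ s₂ : St} {t t' t₁ t₂ : ℕ} {k : Stk}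

lemma of_eq (h : Run p s s' t) (hs : s' = s₁) (ht : t ≤ t') : Run p s s₁ t' :=
  hs ▸ Exec.weaken h ht

lemma mono (h : Run p s s' t) (ht : t ≤ t') : Run p s s' t' := Exec.weaken h ht

lemma skip : Run .skip s s 0 := Exec.skip _

lemma push (k : Stk) (a : Letter) : Run (.push k a) s (s.set k (a :: s.get k)) 0 := by
  unfold Run
  rw [St.get_set]
  exact Exec.push ..

lemma seq (h₁ : Run p s s₁ t₁) (h₂ : Run q s₁ s₂ t₂) : Run (.seq p q) s s₂ (t₁ + t₂) :=
  Exec.seq h₁ h₂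

lemma push_seq {a : Letter} (h : Run p (s.set k (a :: s.get k)) s' t) :
    Run (.seq (.push k a) p) s s' t :=
  (seq (push k a) h).mono (by simp)

lemma pop {f : Option Letter → Prog Stk} (h : Run (f (s.get k).head?) (s.set k (s.get k).tail) s' t) :
    Run (.pop k f) s s' t := by
  unfold Run at *
  rw [St.get_set] at h
  exact Exec.pop h

lemma loop_nil {c : Letter → Bool} {f : Letter → Prog Stk} (h : s.get k = []) :
    Run (.loop k c f) s s 1 := Exec.loop_nil h

lemma loop_exit {c : Letter → Bool} {f : Letter → Prog Stk} {a : Letter} {l : Word}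
    (h : s.get k = a :: l) (ha : c a = false) : Run (.loop k c f) s (s.set k l) 1 := by
  unfold Run
  rw [St.get_set]
  exact Exec.loop_exit h ha

lemma loop_cons {c : Letter → Bool} {f : Letter → Prog Stk} {a : Letter} {l : Word}
    (h : s.get k = a :: l) (ha : c a = true) (h₁ : Run (f a) (s.set k l) s₁ t₁)
    (h₂ : Run (.loop k c f) s₁ s₂ t₂) : Run (.loop k c f) s s₂ (t₁ + t₂ + 1) := by
  unfold Run at *
  rw [St.get_set] at h₁
  exact Exec.loop_cons h ha h₁ h₂

end Run

/-- The unary representation of a number. -/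
abbrev rep (n : ℕ) : Word := List.replicate n (some true)

/-- A loop that removes the letters of a stack one by one. -/
abbrev each (k : Stk) (f : Letter → Prog Stk) : Prog Stk := .loop k (fun _ => true) f

/-- The rule for a loop over a unary number: `I i` are the stacks after `i` rounds. -/
lemma Run.each_rep {k : Stk} {f : Letter → Prog Stk} {n T : ℕ} (I : ℕ → St)
    (hI : ∀ i ≤ n, (I i).get k = rep (n - i))
    (hf : ∀ i < n, Run (f (some true)) ((I i).set k (rep (n - (i + 1)))) (I (i + 1)) T) :
    Run (each k f) (I 0) (I n) (n * (T + 1) + 1) := by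
  -- Induction on the number `j` of rounds still to come, because `Run.loop_cons` peels off the
  -- first round.
  suffices h : ∀ j ≤ n, Run (each k f) (I (n - j)) (I n) (j * (T + 1) + 1) by
    simpa using h n le_rfl
  intro j
  induction j with
  | zero =>
    intro _
    exact (Run.loop_nil (by rw [Nat.sub_zero, hI n le_rfl, Nat.sub_self]; rfl)).mono (by omega)
  | succ j ih =>
    intro hj
    have e : n - (n - (j + 1)) = n - (n - (j + 1) + 1) + 1 := by omega
    have h := hf (n - (j + 1)) (by omega)
    have h₂ := ih (by omega)
    rw [show n - (j + 1) + 1 = n - j by omega] at h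
    refine (Run.loop_cons ?_ rfl h h₂).mono (by ring_nf; omega)
    rw [hI _ (by omega), e, show n - (j + 1) + 1 = n - j by omega]
    rfl

/-- Move the letters of one stack to another one. -/
def move (a b : Stk) : Prog Stk := each a fun x => .push b x

lemma run_move {a b : Stk} (hab : a ≠ b) {s : St} {l : Word} (hl : s.get a = l) :
    Run (move a b) s ((s.set a []).set b (l.reverse ++ s.get b)) (l.length + 1) := by
  induction l generalizing s with
  | nil =>
    unfold Run
    rw [St.get_set, St.get_set]
    have : Function.update (Function.update s.get a []) b ([].reverse ++ s.get b) = s.get := by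
      rw [← hl, Function.update_eq_self]
      simp [hl]
    rw [this]
    exact Exec.loop_nil hl
  | cons x l ih =>
    have h := ih (s := (s.set a l).set b (x :: s.get b))
      (by rw [St.get_set, Function.update_of_ne hab, St.get_set_self])
    have h' : Run (.push b x) (s.set a l) ((s.set a l).set b (x :: s.get b)) 0 := by
      convert Run.push (s := s.set a l) b x using 3
      rw [St.get_set, Function.update_of_ne hab.symm]
    refine (Run.loop_cons hl rfl h' h).of_eq ?_ (by simp)
    rw [St.get_set_self]
    apply St.ext_get
    simp only [St.get_set]
    funext j
    by_cases hb : j = b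
    · subst hb; simp
    · by_cases ha : j = a
      · subst ha; simp [hb]
      · simp [hb, ha]

/-- Empty a stack. -/
def clear (a : Stk) : Prog Stk := each a fun _ => .skip

lemma run_clear {a : Stk} {s : St} {n : ℕ} (h : s.get a = rep n) :
    Run (clear a) s (s.set a []) (n + 1) := by
  have h₁ := Run.each_rep (f := fun _ => .skip) (k := a) (n := n) (T := 0)
    (fun i => s.set a (rep (n - i))) (fun i _ => St.get_set_self ..) (fun i _ => by
      have : (s.set a (rep (n - i))).set a (rep (n - (i + 1))) = s.set a (rep (n - (i + 1))) := by
        cases a <;> rfl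
      exact this ▸ Run.skip)
  have h₂ : s.set a (rep (n - 0)) = s := St.ext_get (by
    rw [St.get_set, Nat.sub_zero, ← h, Function.update_eq_self])
  rw [h₂] at h₁
  exact h₁.of_eq (by simp) (by simp)

/-- Append a word to the output. -/
def emit : Word → Prog Stk
  | [] => .skip
  | a :: l => .seq (.push .out a) (emit l)

/-- Straight-line code passes no loop test, hence the time `0`. -/
lemma run_emit (s : St) (x : Word) : Run (emit x) s { s with out := x.reverse ++ s.out } 0 := by
  induction x generalizing s with
  | nil => exact Run.skip
  | cons a x ih => exact (Run.push_seq (ih _)).of_eq (by simp) le_rfl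

/-- Double the unary number on the stack `u`. -/
def double : Prog Stk :=
  .seq (move .u .v) (each .v fun _ => .seq (.push .u (some true)) (.push .u (some true)))

lemma run_double {s : St} {n : ℕ} (hu : s.u = rep n) (hv : s.v = []) :
    Run double s { s with u := rep (2 * n) } (2 * n + 2) := by
  have h := Run.each_rep (k := .v) (f := fun _ => .seq (.push .u (some true)) (.push .u (some true)))
    (n := n) (T := 0) (fun i => { s with v := rep (n - i), u := rep (2 * i) }) (fun i _ => rfl)
    (fun i _ => Run.push_seq (Run.push ..))
  have h₀ := run_move (a := .u) (b := .v) (by decide) (s := s) (l := rep n) hu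
  refine (Run.seq (h₀.of_eq (s₁ := { s with v := rep (n - 0), u := rep (2 * 0) }) ?_ le_rfl)
    h).of_eq ?_ ?_
  · simp [hv]
  · simp [hv]
  · simp; omega

end Prog

/-! ### Conversion between binary and unary numbers -/

lemma Nat.length_bits_le (n : ℕ) : n.bits.length ≤ n := by
  rw [Nat.size_eq_bits_len]
  exact Nat.size_le.mpr Nat.lt_two_pow_self

lemma Nat.foldr_bits (n : ℕ) : n.bits.foldr (fun b x => 2 * x + b.toNat) 0 = n := by
  induction n using Nat.binaryRec' with
  | zero => simp
  | bit b n h ih => rw [Nat.bits_append_bit n b h, List.foldr_cons, ih, Nat.bit_val]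

/-- Binary increment, least significant bit first. -/
def incBits : List Bool → List Bool
  | [] => [true]
  | false :: l => true :: l
  | true :: l => false :: incBits l

lemma incBits_bits (n : ℕ) : incBits n.bits = (n + 1).bits := by
  induction n using Nat.binaryRec' with
  | zero => simp [incBits]
  | bit b n h ih =>
    rw [Nat.bits_append_bit n b h]
    cases b
    · have : Nat.bit false n + 1 = Nat.bit true n := by simp [Nat.bit_val]
      rw [this, Nat.bits_append_bit n true (by simp), incBits]
    · have : Nat.bit true n + 1 = Nat.bit false (n + 1) := by simp [Nat.bit_val]; ring
      rw [this, Nat.bits_append_bit (n + 1) false (by simp), incBits, ih]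

/-- The carry runs through the leading ones and stops at a zero or at the end of the word. These are
the two ways in which the first loop of `inc` can end. -/
lemma exists_incBits (l : List Bool) : ∃ k r, k ≤ l.length ∧
    (l = List.replicate k true ++ false :: r ∨ (l = List.replicate k true ∧ r = [])) ∧
    incBits l = List.replicate k false ++ true :: r := by
  induction l with
  | nil => exact ⟨0, [], by simp [incBits]⟩
  | cons b l ih =>
    cases b
    · exact ⟨0, l, by simp [incBits]⟩
    · obtain ⟨k, r, hk, h, h'⟩ := ih
      refine ⟨k + 1, r, by simpa using hk, ?_, by simp [incBits, h', List.replicate_succ]⟩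
      rcases h with h | ⟨h, hr⟩
      · left; simp [h, List.replicate_succ]
      · right; simp [← h, hr, List.replicate_succ]

namespace Prog

/-- Read a number from the input and leave its digits on `dig`, most significant bit on top. -/
def readNum : Prog Stk := .loop .inp Option.isSome fun a => .push .dig a

lemma run_readNum {s : St} {l : List Bool} {r : Word} (h : s.inp = l.map some ++ none :: r) :
    Run readNum s { s with inp := r, dig := (l.map some).reverse ++ s.dig } (l.length + 1) := by
  induction l generalizing s with
  | nil => exact (Run.loop_exit (by exact h) rfl).of_eq (by simp) (by simp)
  | cons b l ih =>
    refine (Run.loop_cons (by exact h) rfl (Run.push ..)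
      (ih (s := { s with inp := l.map some ++ none :: r, dig := some b :: s.dig }) rfl)).of_eq ?_ ?_
    · simp
    · simp

/-- Read a number from the input and write it in unary on the stack `u`. -/
def readUnary : Prog Stk :=
  .seq readNum (each .dig fun a => .seq double (if a = some true then .push .u (some true) else .skip))

/-- The intermediate values of Horner's rule only grow, so a bound for the final value bounds the
cost of every doubling. -/
lemma le_foldl (l : List Bool) (x : ℕ) : x ≤ l.foldl (fun x b => 2 * x + b.toNat) x := by
  induction l generalizing x with
  | nil => simp
  | cons b l ih =>
    refine le_trans ?_ (ih _)
    show x ≤ 2 * x + b.toNat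
    omega

lemma run_horner {s : St} {l : List Bool} {x B : ℕ} (hd : s.dig = l.map some) (hu : s.u = rep x)
    (hv : s.v = []) (hB : l.foldl (fun x b => 2 * x + b.toNat) x ≤ B) :
    Run (each .dig fun a => .seq double (if a = some true then .push .u (some true) else .skip)) s
      { s with dig := [], u := rep (l.foldl (fun x b => 2 * x + b.toNat) x) }
      (l.length * (2 * B + 3) + 1) := by
  induction l generalizing s x with
  | nil =>
    refine (Run.loop_nil (by exact hd)).of_eq ?_ (by simp)
    simp only [List.map_nil] at hd
    simp [← hd, ← hu]
  | cons b l ih =>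
    simp only [List.foldl_cons] at hB ⊢
    have hx := le_foldl l (2 * x + b.toNat)
    have h₁ := run_double (s := { s with dig := l.map some }) hu hv
    have h₂ : Run (if some b = some true then .push .u (some true) else .skip)
        { s with dig := l.map some, u := rep (2 * x) }
        { s with dig := l.map some, u := rep (2 * x + b.toNat) } 0 := by
      cases b
      · exact Run.skip
      · exact Run.push ..
    refine (Run.loop_cons (by exact hd) rfl (Run.seq h₁ h₂)
      (ih (s := { s with dig := l.map some, u := rep (2 * x + b.toNat) }) rfl rfl hv hB)).mono ?_
    rw [List.length_cons]
    nlinarith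

/-- The time is polynomial in the value `n`, not in its length. This is harmless: the numbers read
are `ℓ`, `m` and indices of variables. -/
lemma run_readUnary {s : St} {n : ℕ} {r : Word} (h : s.inp = encodeNat n ++ r) (hd : s.dig = [])
    (hu : s.u = []) (hv : s.v = []) :
    Run readUnary s { s with inp := r, u := rep n } (2 * (n + 1) ^ 2) := by
  have h₁ := run_readNum (s := s) (l := n.bits) (r := r) (by simp [h, encodeNat])
  have hn : n.bits.reverse.foldl (fun x b => 2 * x + b.toNat) 0 = n := by
    rw [List.foldl_reverse]
    exact n.foldr_bits
  have h₂ := run_horner (s := { s with inp := r, dig := n.bits.reverse.map some })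
    (l := n.bits.reverse) (x := 0) (B := n) rfl hu hv hn.le
  rw [hn] at h₂
  refine (Run.seq (h₁.of_eq ?_ le_rfl) h₂).of_eq ?_ ?_
  · simp [hd]
  · simp [hd]
  · have := n.length_bits_le
    rw [List.length_reverse]
    nlinarith

/-- Increment the binary number on the stack `bin`. -/
def inc : Prog Stk :=
  .seq (.loop .bin (· == some true) fun _ => .push .w (some true))
    (.seq (.push .bin (some true)) (each .w fun _ => .push .bin (some false)))

lemma run_inc_aux {s : St} {l : List Bool} {k j : ℕ} {r : List Bool} (hs : s.bin = l.map some)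
    (hw : s.w = rep j)
    (h : l = List.replicate k true ++ false :: r ∨ (l = List.replicate k true ∧ r = [])) :
    Run (.loop .bin (· == some true) fun _ => .push .w (some true)) s
      { s with bin := r.map some, w := rep (j + k) } (k + 1) := by
  induction k generalizing s l j with
  | zero =>
    rcases h with h | ⟨h, hr⟩
    · refine (Run.loop_exit (by exact hs.trans (congrArg _ h)) rfl).of_eq ?_ (by simp)
      simp [← hw]
    · refine (Run.loop_nil (by exact hs.trans (congrArg _ h))).of_eq ?_ (by simp)
      have hb : s.bin = [] := by simp [hs, h]
      simp [← hw, hr, ← hb]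
  | succ k ih =>
    obtain ⟨l', hl⟩ : ∃ l', l = true :: l' := by
      rcases h with h | ⟨h, -⟩ <;> rw [h] <;> exact ⟨_, rfl⟩
    subst hl
    have h₁ : Run (.push .w (some true)) { s with bin := l'.map some }
        { s with bin := l'.map some, w := rep (j + 1) } 0 :=
      (Run.push ..).of_eq (by simp [hw, List.replicate_succ]) le_rfl
    refine (Run.loop_cons (by exact hs) rfl h₁ (ih rfl rfl ?_)).of_eq ?_ (by omega)
    · rcases h with h | ⟨h, hr⟩
      · exact .inl (List.cons.inj h).2
      · exact .inr ⟨(List.cons.inj h).2, hr⟩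
    · simp only [add_assoc, add_comm 1 k]

lemma run_inc {s : St} {n : ℕ} (hs : s.bin = n.bits.map some) (hw : s.w = []) :
    Run inc s { s with bin := (n + 1).bits.map some } (2 * n + 2) := by
  obtain ⟨k, r, hk, h, h'⟩ := exists_incBits n.bits
  rw [← incBits_bits, h']
  have hkn := hk.trans n.length_bits_le
  have h₁ := run_inc_aux (s := s) (j := 0) hs hw h
  have h₂ := Run.each_rep (k := .w) (f := fun _ => .push .bin (some false)) (n := k) (T := 0)
    (fun i => { s with
      w := rep (k - i), bin := List.replicate i (some false) ++ some true :: r.map some }) (fun i _ => rfl)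
    (fun i _ => Run.push ..)
  refine (Run.seq (h₁.of_eq (s₁ := { s with w := rep (k - 0), bin := r.map some }) (by simp) le_rfl)
    (Run.push_seq h₂)).of_eq ?_ (by omega)
  simp [← hw]

/-- Write the unary number on the stack `c` to the output. -/
def emitNat : Prog Stk :=
  .seq (each .c fun _ => inc) (.seq (move .bin .out) (.push .out none))

lemma run_emitNat {s : St} {n : ℕ} (hc : s.c = rep n) (hb : s.bin = []) (hw : s.w = []) :
    Run emitNat s { s with c := [], out := (encodeNat n).reverse ++ s.out } (2 * (n + 1) ^ 2) := by
  have h₁ := Run.each_rep (k := .c) (f := fun _ => inc) (n := n) (T := 2 * n + 2)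
    (fun i => { s with c := rep (n - i), bin := i.bits.map some }) (fun i _ => rfl)
    (fun i hi => (run_inc (s := { s with c := rep (n - (i + 1)), bin := i.bits.map some })
      (n := i) rfl hw).mono (by omega))
  have h₂ := run_move (a := .bin) (b := .out) (by decide)
    (s := { s with c := rep (n - n), bin := n.bits.map some }) (l := n.bits.map some) rfl
  have hs : s = { s with c := rep (n - 0), bin := (Nat.bits 0).map some } := by simp [← hc, ← hb]
  rw [hs]
  refine (Run.seq h₁ (Run.seq h₂ (Run.push ..))).of_eq ?_ ?_
  · simp [encodeNat]
  · have := n.length_bits_le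
    rw [List.length_map]
    nlinarith

/-- Write `4 ^ M` to the output, for the unary number `M` on the stack `sq`. -/
def emitPow : Prog Stk :=
  .seq (.push .out (some false)) (.seq (each .sq fun _ => .seq (.push .v (some true))
    (.seq (.push .out (some false)) (.push .out (some false))))
    (.seq (move .v .sq) (.seq (.push .out (some true)) (.push .out none))))

/-- The number `4 ^ M` is too large for unary, but its binary digits can be written down directly
from `M`. This is the reason for bounds that are powers of `4`. -/
lemma bits_four_pow (M : ℕ) : (4 ^ M).bits = List.replicate (2 * M) false ++ [true] := by
  have h : ∀ j, (2 ^ j).bits = List.replicate j false ++ [true] := by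
    intro j
    induction j with
    | zero => simp
    | succ j ih =>
      rw [pow_succ, mul_comm, Nat.bit0_bits _ (by positivity), ih]
      rfl
  rw [show 4 = 2 ^ 2 by rfl, ← pow_mul, h]

lemma run_emitPow {s : St} {M : ℕ} (hs : s.sq = rep M) (hv : s.v = []) :
    Run emitPow s { s with out := (encodeInt (4 ^ M)).reverse ++ s.out } (2 * M + 2) := by
  have h₁ := Run.each_rep (k := .sq) (n := M) (T := 0)
    (f := fun _ => .seq (.push .v (some true))
      (.seq (.push .out (some false)) (.push .out (some false))))
    (fun i => { s with
      sq := rep (M - i), v := rep i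
      out := List.replicate (2 * i) (some false) ++ some false :: s.out }) (fun i _ => rfl)
    (fun i _ => Run.push_seq (Run.push_seq (Run.push ..)))
  have h₂ := run_move (a := .v) (b := .sq) (by decide) (l := rep M)
    (s := { s with
      sq := rep (M - M), v := rep M
      out := List.replicate (2 * M) (some false) ++ some false :: s.out }) rfl
  have hs' : s = { s with sq := rep (M - 0), v := rep 0 } := by simp [← hs, ← hv]
  rw [hs']
  refine Run.push_seq ((Run.seq h₁ (Run.seq h₂ (Run.push_seq (Run.push ..)))).of_eq ?_ ?_)
  · have h4 : ¬ (4 : ℤ) ^ M < 0 := not_lt.mpr (by positivity)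
    have h5 : ((4 : ℤ) ^ M).natAbs = 4 ^ M := by rw [Int.natAbs_pow]; rfl
    simp [encodeInt, encodeNat, h4, h5, bits_four_pow]
  · simp; omega

end Prog

/-! ### Divisibility, primality and the `i`-th prime by counting -/

/-- The position after `k` steps of a counter that runs cyclically through `1, …, b`. -/
def cyc (b : ℕ) : ℕ → ℕ
  | 0 => 0
  | k + 1 => if cyc b k = b then 1 else cyc b k + 1

lemma cyc_le {b : ℕ} (hb : 0 < b) (k : ℕ) : cyc b k ≤ b := by
  induction k with
  | zero => simp [cyc]
  | succ k ih =>
    rw [cyc]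
    split <;> omega

lemma exists_eq_mul_add_cyc (b k : ℕ) : ∃ q, k = b * q + cyc b k := by
  induction k with
  | zero => exact ⟨0, by simp [cyc]⟩
  | succ k ih =>
    obtain ⟨q, hq⟩ := ih
    rw [cyc]
    split
    · rename_i h
      refine ⟨q + 1, ?_⟩
      rw [h] at hq
      rw [mul_add, mul_one, ← hq]
    · exact ⟨q, by omega⟩

/-- For `k > 0` the counter is the representative of `k` modulo `b` in `1, …, b`. At `k = 0` it is
`0` although `b ∣ 0`, so this case is excluded. -/
lemma cyc_eq_iff_dvd {b k : ℕ} (hb : 0 < b) (hk : 0 < k) : cyc b k = b ↔ b ∣ k := by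
  obtain ⟨q, hq⟩ := exists_eq_mul_add_cyc b k
  have hle := cyc_le hb k
  have hpos : 0 < cyc b k := by
    obtain ⟨j, rfl⟩ : ∃ j, k = j + 1 := ⟨k - 1, by omega⟩
    rw [cyc]
    split <;> omega
  constructor
  · intro h
    exact ⟨q + 1, by rw [mul_add, mul_one]; omega⟩
  · intro h
    rw [hq, Nat.dvd_add_right (Dvd.intro _ rfl)] at h
    exact le_antisymm hle (Nat.le_of_dvd hpos h)

namespace Prog

/-- One step of the cyclic counter whose value is on `f`, and whose distance from the end is on
`e`. -/
def cycStep : Prog Stk :=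
  .pop .e fun
    | some _ => .push .f (some true)
    | none => .seq (move .f .e) (.pop .e fun _ => .push .f (some true))

lemma run_cycStep {s : St} {b k : ℕ} (hb : 0 < b) (he : s.e = rep (b - cyc b k))
    (hf : s.f = rep (cyc b k)) :
    Run cycStep s { s with e := rep (b - cyc b (k + 1)), f := rep (cyc b (k + 1)) } (b + 1) := by
  have hle := cyc_le hb k
  refine Run.pop ?_
  rw [cyc]
  -- At the end of a cycle `e` is empty and `f` holds `b`: everything is moved back, and the next
  -- cycle starts at `1`.
  by_cases h : cyc b k = b
  · rw [if_pos h]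
    rw [h, Nat.sub_self] at he
    rw [h] at hf
    have h₁ := run_move (a := .f) (b := .e) (by decide) (s := s) (l := rep b) hf
    have e₀ : s.set .e (s.get .e).tail = s := by cases s; simp_all
    have e₁ : (s.get .e).head? = none := by simp [he]
    rw [e₀, e₁]
    refine (Run.seq h₁ (Run.pop (Run.push ..))).of_eq ?_ (by simp)
    obtain ⟨j, rfl⟩ : ∃ j, b = j + 1 := ⟨b - 1, by omega⟩
    simp [he]
  · rw [if_neg h]
    obtain ⟨j, hj⟩ : ∃ j, b - cyc b k = j + 1 := ⟨b - cyc b k - 1, by omega⟩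
    rw [hj] at he
    have e₁ : (s.get .e).head? = some (some true) := by simp [he, List.replicate_succ]
    rw [e₁]
    refine (Run.push ..).of_eq ?_ (by omega)
    have : b - (cyc b k + 1) = j := by omega
    simp [he, hf, this, List.replicate_succ]

/-- Put a token on `h` if the number on `e` divides the one on `c`. -/
def divTest : Prog Stk :=
  .seq (each .c fun _ => .seq (.push .w (some true)) cycStep) (.seq (move .w .c)
    (.seq (.pop .e fun
      | some _ => .push .e (some true)
      | none => .push .h (some true)) (move .f .e)))

/-- After `d` steps of the counter with period `b`, the stack `e` is empty exactly if `b ∣ d`. Both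
numbers are restored afterwards for the next trial divisor. -/
lemma run_divTest {s : St} {b d : ℕ} (hb : 0 < b) (hd : 0 < d) (hc : s.c = rep d)
    (he : s.e = rep b) (hf : s.f = []) (hw : s.w = []) :
    Run divTest s { s with h := if b ∣ d then some true :: s.h else s.h }
      ((d + 1) * (b + 2) + d + b + 2) := by
  have h₁ := Run.each_rep (k := .c) (n := d) (T := b + 1)
    (f := fun _ => .seq (.push .w (some true)) cycStep)
    (fun i => { s with c := rep (d - i), w := rep i, e := rep (b - cyc b i), f := rep (cyc b i) })
    (fun i _ => rfl)
    (fun i hi => Run.push_seq (run_cycStep (k := i) hb rfl rfl))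
  have e₀ : s = { s with c := rep (d - 0), w := rep 0, e := rep (b - cyc b 0), f := rep (cyc b 0) } := by
    cases s; simp_all [cyc]
  have h₂ := run_move (a := .w) (b := .c) (by decide) (l := rep d)
    (s := { s with c := rep (d - d), w := rep d, e := rep (b - cyc b d), f := rep (cyc b d) }) rfl
  have h₂' := h₂.of_eq (s₁ := { s with e := rep (b - cyc b d), f := rep (cyc b d) })
    (by simp [hc, hw]) le_rfl
  have hle := cyc_le hb d
  have h₃ : Run (.pop .e fun
      | some _ => .push .e (some true)
      | none => .push .h (some true)) { s with e := rep (b - cyc b d), f := rep (cyc b d) }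
      { s with e := rep (b - cyc b d), f := rep (cyc b d),
               h := if b ∣ d then some true :: s.h else s.h } 0 := by
    refine Run.pop ?_
    by_cases h : b ∣ d
    · have h' := (cyc_eq_iff_dvd hb hd).mpr h
      rw [if_pos h, h', Nat.sub_self]
      exact Run.push ..
    · have h' := (cyc_eq_iff_dvd hb hd).not.mpr h
      obtain ⟨j, hj⟩ : ∃ j, b - cyc b d = j + 1 := ⟨b - cyc b d - 1, by omega⟩
      rw [if_neg h, hj]
      exact Run.push ..
  have h₄ := run_move (a := .f) (b := .e) (by decide) (l := rep (cyc b d))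
    (s := { s with e := rep (b - cyc b d), f := rep (cyc b d),
                   h := if b ∣ d then some true :: s.h else s.h }) rfl
  rw [← e₀] at h₁
  refine (Run.seq h₁ (Run.seq h₂' (Run.seq h₃ h₄))).of_eq ?_ ?_
  · have : (rep (cyc b d)).reverse ++ rep (b - cyc b d) = rep b := by
      rw [List.reverse_replicate, ← List.replicate_add, Nat.add_sub_cancel' hle]
    simp only [St.set.eq_9, St.set.eq_10, St.get.eq_9, this]
    rw [← he, ← hf]
  · simp only [List.length_replicate]
    nlinarith

/-- Put a token on `fl` if the number on `c` is not prime. -/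
def primeTest : Prog Stk :=
  .seq (each .c fun _ => .seq (.push .w (some true)) (.push .g (some true))) (.seq (move .w .c)
    (.seq (.pop .g fun _ => .pop .g fun _ => .push .e (some true))
    (.seq (each .g fun _ => .seq (.push .e (some true)) divTest) (.seq (clear .e)
    (.seq (.pop .h fun
      | some _ => .push .fl (some true)
      | none => .skip) (clear .h))))))

/-- The number of divisors of `d` among `2, …, i + 1`. -/
def divCount (d i : ℕ) : ℕ := ((Finset.range i).filter fun j => j + 2 ∣ d).card

lemma divCount_succ (d i : ℕ) :
    divCount d (i + 1) = if i + 2 ∣ d then divCount d i + 1 else divCount d i := by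
  unfold divCount
  rw [Finset.range_add_one, Finset.filter_insert]
  split
  · rw [Finset.card_insert_of_notMem (by simp)]
  · rfl

/-- Trial division: the candidates `j + 2` with `j < d - 2` are exactly `2, …, d - 1`. -/
lemma divCount_eq_zero_iff {d : ℕ} (hd : 2 ≤ d) : divCount d (d - 2) = 0 ↔ d.Prime := by
  rw [divCount, Finset.card_eq_zero, Finset.filter_eq_empty_iff, Nat.prime_def_lt']
  refine ⟨fun h => ⟨hd, fun m h2 hm => ?_⟩, fun h j hj => h.2 _ (by omega) ?_⟩
  · have := @h (m - 2) (by simp; omega)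
    rwa [Nat.sub_add_cancel h2] at this
  · have := Finset.mem_range.mp hj
    omega

lemma divCount_le (d i : ℕ) : divCount d i ≤ i :=
  (Finset.card_filter_le _ _).trans (by simp)

lemma run_primeTest {s : St} {d : ℕ} (hd : 2 ≤ d) (hc : s.c = rep d) (hw : s.w = [])
    (hg : s.g = []) (he : s.e = []) (hf : s.f = []) (hh : s.h = []) :
    Run primeTest s { s with fl := if d.Prime then s.fl else some true :: s.fl }
      (10 * (d + 1) ^ 3) := by
  have h₁ := Run.each_rep (k := .c) (n := d) (T := 0)
    (f := fun _ => .seq (.push .w (some true)) (.push .g (some true)))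
    (fun i => { s with c := rep (d - i), w := rep i, g := rep i })
    (fun i _ => rfl) (fun i hi => Run.push_seq (Run.push ..))
  have h₂ := run_move (a := .w) (b := .c) (by decide) (l := rep d)
    (s := { s with c := rep (d - d), w := rep d, g := rep d }) rfl
  have e₂ : (({ s with c := rep (d - d), w := rep d, g := rep d } : St).set .w []).set .c
      ((rep d).reverse ++ rep (d - d)) = { s with g := rep d } := by cases s; simp_all
  -- Two units are dropped from the copy of `d`, leaving `d - 2` rounds; the candidate on `e` starts
  -- at `1` because each round increments it before testing.
  have h₃ : Run (.pop .g fun _ => .pop .g fun _ => .push .e (some true)) { s with g := rep d }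
      { s with g := rep (d - 2), e := rep 1 } 0 := by
    refine Run.pop (Run.pop ((Run.push ..).of_eq ?_ le_rfl))
    cases s
    simp_all [Nat.sub_sub]
  have h₄ := Run.each_rep (k := .g) (n := d - 2) (T := (d + 1) * (d + 2) + d + d + 2)
    (f := fun _ => .seq (.push .e (some true)) divTest)
    (fun i => { s with g := rep (d - 2 - i), e := rep (i + 1), h := rep (divCount d i) })
    (fun i _ => rfl) (fun i hi => Run.push_seq ((run_divTest (s := { s with
      g := rep (d - 2 - (i + 1)), e := rep (i + 2), h := rep (divCount d i) }) (b := i + 2) (d := d) (by omega)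
      (by omega) hc rfl hf hw).of_eq (by
        rw [divCount_succ]
        split <;> rfl) (by gcongr <;> omega)))
  have e₄ : ({ s with g := rep (d - 2), e := rep 1 } : St)
      = { s with g := rep (d - 2 - 0), e := rep (0 + 1), h := rep (divCount d 0) } := by
    cases s; simp_all [divCount]
  have h₅ := run_clear (a := .e) (s := { s with
    g := rep (d - 2 - (d - 2)), e := rep (d - 2 + 1), h := rep (divCount d (d - 2)) }) rfl
  -- However many divisors were counted on `h`, only one token goes to `fl`, so the loop of
  -- `nextPrime` makes just one more round.
  have h₆ : Run (.pop .h fun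
      | some _ => .push .fl (some true)
      | none => .skip) { s with h := rep (divCount d (d - 2)) }
      { s with h := rep (divCount d (d - 2) - 1),
               fl := if d.Prime then s.fl else some true :: s.fl } 0 := by
    refine Run.pop ?_
    by_cases h : d.Prime
    · rw [if_pos h, (divCount_eq_zero_iff hd).mpr h]
      exact Run.skip
    · obtain ⟨j, hj⟩ : ∃ j, divCount d (d - 2) = j + 1 :=
        Nat.exists_eq_succ_of_ne_zero (mt (divCount_eq_zero_iff hd).mp h)
      rw [if_neg h, hj]
      exact Run.push ..
  have h₇ := run_clear (a := .h) (s := { s with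
    h := rep (divCount d (d - 2) - 1), fl := if d.Prime then s.fl else some true :: s.fl }) rfl
  have e₁ : s = { s with c := rep (d - 0), w := rep 0, g := rep 0 } := by cases s; simp_all
  rw [← e₁] at h₁
  rw [← e₄] at h₄
  refine (Run.seq h₁ (Run.seq (h₂.of_eq e₂ le_rfl) (Run.seq h₃ (Run.seq h₄ (Run.seq
    (h₅.of_eq ?_ le_rfl) (Run.seq h₆ h₇)))))).of_eq ?_ ?_
  · cases s; simp_all
  · cases s; simp_all
  · have := divCount_le d (d - 2)
    have h2 : d - 2 ≤ d := by omega
    have h3 : (d - 2) * ((d + 1) * (d + 2) + d + d + 2 + 1)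
      ≤ d ^ 3 + 5 * d ^ 2 + 5 * d := (Nat.mul_le_mul_right _ h2).trans_eq (by ring)
    have h4 : divCount d (d - 2) - 1 ≤ d := by omega
    have h5 : 10 * (d + 1) ^ 3 = 10 * d ^ 3 + 30 * d ^ 2 + 30 * d + 10 := by ring
    rw [List.length_replicate, h5]
    have := Nat.zero_le (d ^ 3)
    have := Nat.zero_le (d ^ 2)
    linarith

/-- Replace the number on `c` by the next prime. -/
def nextPrime : Prog Stk :=
  .seq (.push .fl (some true)) (each .fl fun _ => .seq (.push .c (some true)) primeTest)

/-- The token on `fl` keeps the loop running: each round removes it, and a composite candidate puts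
it back. The induction is on the number `j` of candidates skipped before `q`. -/
lemma run_nextPrime_aux {j : ℕ} : ∀ {s : St} {d q : ℕ}, q = d + 1 + j → 0 < d → q.Prime →
    (∀ x, d < x → x < q → ¬ x.Prime) → s.c = rep d → s.w = [] → s.g = [] → s.e = [] → s.f = [] →
    s.h = [] → s.fl = [some true] →
    Run (each .fl fun _ => .seq (.push .c (some true)) primeTest) s { s with c := rep q, fl := [] }
      ((j + 1) * (10 * (q + 1) ^ 3 + 1) + 1) := by
  induction j with
  | zero =>
    intro s d q hq hd hp hn hc hw hg he hf hh hfl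
    subst hq
    have h₁ : Run (.seq (.push .c (some true)) primeTest) (s.set .fl [])
        { s with c := rep (d + 1), fl := [] } (10 * (d + 1 + 1) ^ 3) := by
      refine Run.push_seq ((run_primeTest (s := { s with c := some true :: s.c, fl := [] })
        (d := d + 1) (by omega) ?_ hw hg he hf hh).of_eq ?_ le_rfl)
      · simp [hc, List.replicate_succ]
      · rw [if_pos (by exact hp)]
        simp [hc, List.replicate_succ]
    exact (Run.loop_cons (by exact hfl) rfl h₁ (Run.loop_nil rfl)).mono (by simp only [add_zero]; omega)
  | succ j ih =>
    intro s d q hq hd hp hn hc hw hg he hf hh hfl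
    have h₁ : Run (.seq (.push .c (some true)) primeTest) (s.set .fl [])
        { s with c := rep (d + 1) } (10 * (q + 1) ^ 3) := by
      refine Run.push_seq ((run_primeTest (s := { s with c := some true :: s.c, fl := [] })
        (d := d + 1) (by omega) ?_ hw hg he hf hh).of_eq ?_ ?_)
      · simp [hc, List.replicate_succ]
      · rw [if_neg (hn _ (by omega) (by omega))]
        cases s
        simp_all [List.replicate_succ]
      · gcongr
        omega
    refine (Run.loop_cons (by exact hfl) rfl h₁ (ih (s := { s with c := rep (d + 1) }) (d := d + 1)
      (q := q) (by omega) (by omega) hp (fun x hx => hn x (by omega)) rfl hw hg he hf hh hfl)).mono ?_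
    nlinarith

lemma run_nextPrime {s : St} {d q : ℕ} (hd : 0 < d) (hdq : d < q) (hp : q.Prime)
    (hn : ∀ x, d < x → x < q → ¬ x.Prime) (hc : s.c = rep d) (hw : s.w = []) (hg : s.g = [])
    (he : s.e = []) (hf : s.f = []) (hh : s.h = []) (hfl : s.fl = []) :
    Run nextPrime s { s with c := rep q } (11 * (q + 1) ^ 4) := by
  refine Run.push_seq ((run_nextPrime_aux (s := { s with fl := some true :: s.fl })
    (j := q - d - 1) (d := d) (q := q) (by omega) hd hp hn hc hw hg he hf hh (by simp [hfl])).of_eq ?_ ?_)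
  · cases s; simp_all
  · have h1 : (q - d - 1 + 1) * (10 * (q + 1) ^ 3 + 1) ≤ q * (10 * (q + 1) ^ 3 + 1) :=
      Nat.mul_le_mul_right _ (by omega)
    have h2 : 0 < (q + 1) ^ 3 := by positivity
    nlinarith

/-- Replace the number `i` on `u` by the `i`-th prime on `c`. -/
def nthPrime : Prog Stk :=
  .seq (.push .c (some true)) (.seq (.push .u (some true)) (each .u fun _ => nextPrime))

/-- `1`, and then the primes. -/
noncomputable def oneOrPrime : ℕ → ℕ
  | 0 => 1
  | i + 1 => Nat.nth Nat.Prime i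

lemma oneOrPrime_lt_succ (i : ℕ) : oneOrPrime i < oneOrPrime (i + 1) := by
  cases i with
  | zero => exact (Nat.prime_nth_prime 0).one_lt
  | succ i => exact Nat.nth_strictMono Nat.infinite_setOfPred_prime (Nat.lt_succ_self i)

/-- A prime `x` is the prime with index `Nat.count Nat.Prime x`, and no index lies strictly between
consecutive ones. -/
lemma not_prime_of_between {i x : ℕ} (h₁ : oneOrPrime i < x) (h₂ : x < oneOrPrime (i + 1)) :
    ¬ x.Prime := by
  intro hx
  rw [← Nat.nth_count hx] at h₁ h₂
  rw [oneOrPrime, Nat.nth_lt_nth Nat.infinite_setOfPred_prime] at h₂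
  cases i with
  | zero => omega
  | succ i =>
    rw [oneOrPrime, Nat.nth_lt_nth Nat.infinite_setOfPred_prime] at h₁
    omega

lemma run_nthPrime {s : St} {i : ℕ} (hu : s.u = rep i) (hc : s.c = []) (hw : s.w = [])
    (hg : s.g = []) (he : s.e = []) (hf : s.f = []) (hh : s.h = []) (hfl : s.fl = []) :
    Run nthPrime s { s with u := [], c := rep (Nat.nth Nat.Prime i) }
      ((i + 1) * (11 * (Nat.nth Nat.Prime i + 1) ^ 4 + 1) + 1) := by
  have mono : StrictMono oneOrPrime := strictMono_nat_of_lt_succ oneOrPrime_lt_succ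
  -- Indices of primes start at `0`, so `i + 1` searches are made, beginning at `1`.
  have h := Run.each_rep (k := .u) (n := i + 1) (T := 11 * (Nat.nth Nat.Prime i + 1) ^ 4)
    (f := fun _ => nextPrime) (fun j => { s with u := rep (i + 1 - j), c := rep (oneOrPrime j) })
    (fun j _ => rfl) (fun j hj => (run_nextPrime
      (s := { s with u := rep (i + 1 - (j + 1)), c := rep (oneOrPrime j) }) (d := oneOrPrime j) (q := oneOrPrime (j + 1))
      (lt_of_lt_of_le one_pos (mono.monotone (Nat.zero_le j))) (oneOrPrime_lt_succ j)
      (Nat.prime_nth_prime j) (fun x h₁ h₂ => not_prime_of_between h₁ h₂) rfl hw hg he hf hh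
      hfl).of_eq rfl (by
        have : oneOrPrime (j + 1) ≤ oneOrPrime (i + 1) := mono.monotone (by omega)
        gcongr
        exact this))
  have e₀ : ((s.set .c (some true :: s.get .c)).set .u
      (some true :: (s.set .c (some true :: s.get .c)).get .u))
      = { s with u := rep (i + 1 - 0), c := rep (oneOrPrime 0) } := by
    simp [hu, hc, oneOrPrime, List.replicate_succ]
  refine Run.push_seq (Run.push_seq ?_)
  rw [e₀]
  exact h.of_eq (by simp [oneOrPrime]) le_rfl

end Prog

/-! ### The word written by the reduction -/

/-- The encoding of a vector of `k` zeros. -/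
def zeros (k : ℕ) : Word := (List.replicate k (encodeInt 0)).flatten

/-- The beginning of the row of a literal: the coefficients up to the sign of the modulus. -/
def rowHead (j : ℕ) : Word := encodeInt 1 ++ zeros (2 * j) ++ [some true]

/-- The end of the row of a literal: the coefficients after the modulus, and the right-hand side. -/
def rowTail (j : ℕ) (b : Bool) : Word :=
  encodeInt (if b then -1 else 1) ++ zeros (5 - 2 * j) ++ encodeInt (if b then 0 else 1)

/-- The row of the literal `a` at position `j` of its clause. -/
noncomputable def rowWord {ℓ : ℕ} (j : ℕ) (a : Fin ℓ × Bool) : Word :=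
  rowHead j ++ encodeNat (Nat.nth Nat.Prime a.1) ++ rowTail j a.2

/-- The last row of the block of a clause, and the lower bounds of the block. -/
def lastRow : Word :=
  encodeInt 0 ++ (encodeInt 0 ++ encodeInt 1 ++ encodeInt 0 ++ encodeInt 1 ++ encodeInt 0 ++
    encodeInt 1 ++ encodeInt (-1)) ++ encodeInt 1 ++ zeros 7

/-- The block of a clause after the rows of the literals. -/
def blockTail (M : ℕ) : Word :=
  lastRow ++ encodeInt (4 ^ M) ++ encodeInt 1 ++ encodeInt (4 ^ M) ++ encodeInt 1 ++
    encodeInt (4 ^ M) ++ (encodeInt 1 ++ encodeInt 2 ++ zeros 7)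

/-- The block of a clause. -/
noncomputable def clauseWord {ℓ : ℕ} (M : ℕ) (C : Fin 3 → Fin ℓ × Bool) : Word :=
  rowWord 0 (C 0) ++ rowWord 1 (C 1) ++ rowWord 2 (C 2) ++ blockTail M

/-- The dimensions of the blocks, and the lower bound of the common variable. -/
def dimWord : Word := encodeNat 4 ++ encodeNat 1 ++ encodeNat 7 ++ encodeInt 0

/-- The output of the reduction. -/
noncomputable def outWord {ℓ : ℕ} (φ : Formula3 ℓ) (M : ℕ) : Word :=
  encodeNat (M + φ.length) ++ dimWord ++ encodeInt (4 ^ M) ++ encodeInt 0 ++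
    (List.replicate M (zeros 57)).flatten ++ φ.flatMap (clauseWord M)

/-! ### The program of the reduction -/

namespace Prog

/-- Translate a literal with sign `b` at position `j` of its clause. -/
def litProg (j : ℕ) (b : Bool) : Prog Stk :=
  .seq readUnary (.seq nthPrime (.seq (emit (rowHead j)) (.seq emitNat (emit (rowTail j b)))))

/-- The time to translate a literal with variable at most `N` and modulus at most `P`. -/
def litTime (N P : ℕ) : ℕ :=
  2 * (N + 1) ^ 2 + ((N + 1) * (11 * (P + 1) ^ 4 + 1) + 1 + 2 * (P + 1) ^ 2)

lemma run_litProg {ℓ : ℕ} (j : ℕ) (a : Fin ℓ × Bool) {r o : Word} {M N P : ℕ} (hN : a.1 ≤ N)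
    (hP : Nat.nth Nat.Prime a.1 ≤ P) :
    Run (litProg j a.2) { inp := encodeNat a.1 ++ r, out := o, sq := rep M }
      { inp := r, out := (rowWord j a).reverse ++ o, sq := rep M } (litTime N P) := by
  have h₁ := run_readUnary (s := { inp := encodeNat a.1 ++ r, out := o, sq := rep M })
    (n := a.1) (r := r) rfl rfl rfl rfl
  have h₂ := run_nthPrime (s := { inp := r, out := o, sq := rep M, u := rep a.1 })
    (i := a.1) rfl rfl rfl rfl rfl rfl rfl rfl
  have h₃ := run_emit { inp := r, out := o, sq := rep M, c := rep (Nat.nth Nat.Prime a.1) }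
    (rowHead j)
  have h₄ := run_emitNat (s := {
    inp := r, out := (rowHead j).reverse ++ o, sq := rep M, c := rep (Nat.nth Nat.Prime a.1) }) (n := Nat.nth Nat.Prime a.1) rfl rfl rfl
  have h₅ := run_emit { inp := r, out := (encodeNat (Nat.nth Nat.Prime a.1)).reverse ++
    ((rowHead j).reverse ++ o), sq := rep M } (rowTail j a.2)
  refine (Run.seq h₁ (Run.seq h₂ (Run.seq h₃ (Run.seq h₄ h₅)))).of_eq ?_ ?_
  · simp [rowWord]
  · unfold litTime
    rw [zero_add, add_zero]
    gcongr

/-- Write the block of a clause after the rows of the literals. -/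
def tailProg : Prog Stk :=
  .seq (emit lastRow) (.seq emitPow (.seq (emit (encodeInt 1)) (.seq emitPow
    (.seq (emit (encodeInt 1)) (.seq emitPow (emit (encodeInt 1 ++ encodeInt 2 ++ zeros 7)))))))

lemma run_tailProg {r o : Word} {M : ℕ} :
    Run tailProg { inp := r, out := o, sq := rep M }
      { inp := r, out := (blockTail M).reverse ++ o, sq := rep M } (3 * (2 * M + 2)) := by
  have hp := fun o : Word => run_emitPow (s := { inp := r, out := o, sq := rep M }) (M := M) rfl rfl
  have he := fun o : Word => run_emit { inp := r, out := o, sq := rep M }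
  refine (Run.seq (he _ _) (Run.seq (hp _) (Run.seq (he _ _) (Run.seq (hp _)
    (Run.seq (he _ _) (Run.seq (hp _) (he _ _))))))).of_eq ?_ (by omega)
  simp [blockTail]

/-- Translate the clauses. -/
def clausesProg : Prog Stk :=
  each .inp fun a => .seq (litProg 0 (a == some true))
    (.seq (.pop .inp fun o => litProg 1 (o == some (some true)))
      (.seq (.pop .inp fun o => litProg 2 (o == some (some true))) tailProg))

lemma run_clausesProg {ℓ : ℕ} (φ : Formula3 ℓ) {o : Word} {M N P : ℕ} (hN : ℓ ≤ N)
    (hP : ∀ i < ℓ, Nat.nth Nat.Prime i ≤ P) :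
    Run clausesProg
      { inp := φ.flatMap fun C => Formula3.encodeLiteral (C 0) ++ Formula3.encodeLiteral (C 1) ++
          Formula3.encodeLiteral (C 2), out := o, sq := rep M }
      { out := (φ.flatMap (clauseWord M)).reverse ++ o, sq := rep M }
      (φ.length * (3 * litTime N P + 3 * (2 * M + 2) + 1) + 1) := by
  induction φ generalizing o with
  | nil => exact (Run.loop_nil rfl).mono (by simp)
  | cons C φ ih =>
    have hl := fun (j : ℕ) (i : Fin 3) (r o : Word) => run_litProg j (C i) (r := r) (o := o) (M := M)
      ((C i).1.2.le.trans hN) (hP _ (C i).1.2)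
    have hb : ∀ b : Bool, (some b == some true) = b := by decide
    have hb' : ∀ b : Bool, (some (some b) == some (some true)) = b := by decide
    set r := φ.flatMap fun C => Formula3.encodeLiteral (C 0) ++ Formula3.encodeLiteral (C 1) ++
      Formula3.encodeLiteral (C 2) with hr
    have h₀ := hl 0 0 (Formula3.encodeLiteral (C 1) ++ (Formula3.encodeLiteral (C 2) ++ r)) o
    have h₁ := hl 1 1 (Formula3.encodeLiteral (C 2) ++ r) ((rowWord 0 (C 0)).reverse ++ o)
    have h₂ := hl 2 2 r ((rowWord 1 (C 1)).reverse ++ ((rowWord 0 (C 0)).reverse ++ o))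
    have h₃ := run_tailProg (r := r) (o := (rowWord 2 (C 2)).reverse ++
      ((rowWord 1 (C 1)).reverse ++ ((rowWord 0 (C 0)).reverse ++ o))) (M := M)
    rw [← hb (C 0).2] at h₀
    rw [← hb' (C 1).2] at h₁
    rw [← hb' (C 2).2] at h₂
    -- The loop test itself consumes the sign bit of the first literal; those of the other two are
    -- popped inside the body.
    refine (Run.loop_cons (a := some (C 0).2) (l := encodeNat (C 0).1 ++
      (Formula3.encodeLiteral (C 1) ++ (Formula3.encodeLiteral (C 2) ++ r))) ?_ rfl
      (Run.seq h₀ (Run.seq (Run.pop h₁) (Run.seq (Run.pop h₂) h₃))) ih).of_eq ?_ ?_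
    · simp [Formula3.encodeLiteral, hr]
    · simp [clauseWord]
    · rw [List.length_cons]
      ring_nf
      omega

/-- Write the blocks of zeros. -/
def zerosProg : Prog Stk :=
  .seq (each .sq fun _ => .seq (.push .v (some true)) (emit (zeros 57))) (move .v .sq)

lemma run_zerosProg {r o : Word} {M : ℕ} :
    Run zerosProg { inp := r, out := o, sq := rep M }
      { inp := r, out := (List.replicate M (zeros 57)).flatten.reverse ++ o, sq := rep M }
      (2 * M + 2) := by
  have h₁ := Run.each_rep (k := .sq) (n := M) (T := 0)
    (f := fun _ => .seq (.push .v (some true)) (emit (zeros 57)))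
    (fun i => { inp := r, out := (List.replicate i (zeros 57)).flatten.reverse ++ o,
                sq := rep (M - i), v := rep i }) (fun i _ => rfl)
    (fun i hi => Run.push_seq ((run_emit _ _).of_eq (by
      simp [List.replicate_succ']
      exact List.replicate_succ') le_rfl))
  have h₂ := run_move (a := .v) (b := .sq) (by decide) (l := rep M)
    (s := { inp := r, out := (List.replicate M (zeros 57)).flatten.reverse ++ o,
            sq := rep (M - M), v := rep M }) rfl
  refine (Run.seq h₁ h₂).of_eq ?_ ?_
  · simp
  · simp; omega

/-- Read the number of variables and of clauses, and compute the number of zero blocks on `sq` and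
the number of blocks on `c`. -/
def sizeProg : Prog Stk :=
  .seq readUnary (.seq (move .u .nn) (.seq readUnary
    (.seq (each .u fun _ => .seq (.push .nn (some true)) (.push .cnt (some true)))
    (.seq (.push .nn (some true)) (.seq (.push .nn (some true))
    (.seq (each .nn fun _ => .seq (.push .w (some true)) (.push .mm (some true)))
    (.seq (each .w fun _ => .seq (each .mm fun _ => .seq (.push .nn (some true))
        (.seq (.push .sq (some true)) (.push .cnt (some true)))) (move .nn .mm))
    (.seq (clear .mm) (move .cnt .c)))))))))

/-- The number `N` is built on `nn` and copied to `w` and `mm`. Each of the `N` rounds over `w` adds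
`N` to `sq` and to `cnt`; the latter starts at `m`, so it ends as the number of blocks. -/
lemma run_sizeProg {r : Word} {ℓ m N : ℕ} (hN : N = ℓ + m + 2) :
    Run sizeProg { inp := encodeNat ℓ ++ (encodeNat m ++ r) }
      { inp := r, sq := rep (N ^ 2), c := rep (N ^ 2 + m) } (20 * (N + 1) ^ 2) := by
  have h₁ := run_readUnary (s := { inp := encodeNat ℓ ++ (encodeNat m ++ r) }) rfl rfl rfl rfl
  have h₂ := run_move (a := .u) (b := .nn) (by decide) (l := rep ℓ)
    (s := { inp := encodeNat m ++ r, u := rep ℓ }) rfl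
  have h₃ := run_readUnary (s := { inp := encodeNat m ++ r, nn := rep ℓ }) rfl rfl rfl rfl
  have h₄ := Run.each_rep (k := .u) (n := m) (T := 0)
    (f := fun _ => .seq (.push .nn (some true)) (.push .cnt (some true)))
    (fun i => { inp := r, nn := rep (ℓ + i), u := rep (m - i), cnt := rep i }) (fun i _ => rfl)
    (fun i _ => Run.push_seq (Run.push ..))
  have h₅ := Run.each_rep (k := .nn) (n := N) (T := 0)
    (f := fun _ => .seq (.push .w (some true)) (.push .mm (some true)))
    (fun i => { inp := r, nn := rep (N - i), w := rep i, mm := rep i, cnt := rep m }) (fun i _ => rfl)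
    (fun i _ => Run.push_seq (Run.push ..))
  have e₅ : ({ inp := r, nn := some true :: some true :: rep (ℓ + m), u := rep (m - m),
               cnt := rep m } : St)
      = { inp := r, nn := rep (N - 0), w := rep 0, mm := rep 0, cnt := rep m } := by
    simp [hN, List.replicate_succ]
  rw [← e₅] at h₅
  have h₆ := fun j => Run.each_rep (k := .mm) (n := N) (T := 0)
    (f := fun _ => .seq (.push .nn (some true)) (.seq (.push .sq (some true)) (.push .cnt (some true))))
    (fun i => { inp := r, mm := rep (N - i), w := rep (N - (j + 1)), nn := rep i,
                sq := rep (N * j + i), cnt := rep (N * j + m + i) }) (fun i _ => rfl)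
    (fun i _ => Run.push_seq (Run.push_seq (Run.push ..)))
  have h₇ := fun j => run_move (a := .nn) (b := .mm) (by decide) (l := rep N)
    (s := { inp := r, mm := rep (N - N), w := rep (N - (j + 1)), nn := rep N,
            sq := rep (N * j + N), cnt := rep (N * j + m + N) }) rfl
  have h₈ := Run.each_rep (k := .w) (n := N) (T := 2 * N + 2)
    (f := fun _ => .seq (each .mm fun _ => .seq (.push .nn (some true))
        (.seq (.push .sq (some true)) (.push .cnt (some true)))) (move .nn .mm))
    (fun j => { inp := r, mm := rep N, w := rep (N - j),
                sq := rep (N * j), cnt := rep (N * j + m) }) (fun i _ => rfl)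
    (fun j _ => (Run.seq (h₆ j) (h₇ j)).of_eq (by
      simp [mul_add, add_right_comm]) (by simp; omega))
  have h₉ := run_clear (a := .mm) (n := N) (s := {
    inp := r, mm := rep N, w := rep (N - N), sq := rep (N * N), cnt := rep (N * N + m) }) rfl
  have h₁₀ := run_move (a := .cnt) (b := .c) (by decide) (l := rep (N * N + m))
    (s := { inp := r, sq := rep (N * N), cnt := rep (N * N + m) }) rfl
  refine (Run.seq h₁ (Run.seq (h₂.of_eq (s₁ := { inp := encodeNat m ++ r, nn := rep ℓ })
    (by simp) le_rfl) (Run.seq h₃ (Run.seq h₄ (Run.push_seq (Run.push_seq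
    (Run.seq (h₅.of_eq (by simp) le_rfl) (Run.seq h₈ (Run.seq (h₉.of_eq (by simp) le_rfl) h₁₀))))))))).of_eq ?_ ?_
  · simp [sq]
  · simp only [List.length_replicate]
    have : ℓ ≤ N := by omega
    have : m ≤ N := by omega
    nlinarith

/-- The program of the reduction. -/
def reduction : Prog Stk :=
  .seq sizeProg (.seq emitNat (.seq (emit dimWord) (.seq emitPow (.seq (emit (encodeInt 0))
    -- The number on `sq` is erased at the end because `outputsWithin_compose` wants all stacks but
    -- the output empty.
    (.seq zerosProg (.seq clausesProg (clear .sq)))))))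

/-- The running time of `reduction` for `N = ℓ + m + 2` and moduli up to `P`. -/
def reductionTime (N P : ℕ) : ℕ :=
  20 * (N + 1) ^ 2 + (2 * (N ^ 2 + N + 1) ^ 2 + (2 * N ^ 2 + 2 + (2 * N ^ 2 + 2 +
    (N * (3 * litTime N P + 3 * (2 * N ^ 2 + 2) + 1) + 1 + (N ^ 2 + 1)))))

/-- The reduction computes `outWord`. -/
lemma run_reduction {ℓ : ℕ} (φ : Formula3 ℓ) {N P : ℕ} (hN : N = ℓ + φ.length + 2)
    (hP : ∀ i < ℓ, Nat.nth Nat.Prime i ≤ P) :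
    Run reduction { inp := φ.encode } { out := (outWord φ (N ^ 2)).reverse }
      (reductionTime N P) := by
  set r := φ.flatMap fun C => Formula3.encodeLiteral (C 0) ++ Formula3.encodeLiteral (C 1) ++
      Formula3.encodeLiteral (C 2) with hr
  have h₁ := run_sizeProg (r := r) hN
  rw [← List.append_assoc] at h₁
  have h₂ := run_emitNat (s := { inp := r, sq := rep (N ^ 2), c := rep (N ^ 2 + φ.length) })
    rfl rfl rfl
  have hp := fun o : Word => run_emitPow (s := { inp := r, out := o, sq := rep (N ^ 2) }) rfl rfl
  have he := fun o : Word => run_emit { inp := r, out := o, sq := rep (N ^ 2) }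
  have h₃ := fun o : Word => run_zerosProg (r := r) (o := o) (M := N ^ 2)
  have h₄ := fun o : Word => run_clausesProg φ (o := o) (M := N ^ 2) (N := N) (by omega) hP
  have h₅ := fun o : Word => run_clear (a := .sq) (s := { out := o, sq := rep (N ^ 2) }) rfl
  refine (Run.seq h₁ (Run.seq h₂ (Run.seq (he _ _) (Run.seq (hp _) (Run.seq (he _ _)
    (Run.seq (h₃ _) (Run.seq (h₄ _) (h₅ _)))))))).of_eq ?_ ?_
  · simp [outWord]
  · have : φ.length ≤ N := by omega
    unfold reductionTime
    rw [zero_add, zero_add]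
    gcongr

end Prog

/-! ### The reduction from 3-SAT to 2-stage stochastic ILPs -/

/-- The modulus of a variable. -/
noncomputable abbrev modulus (i : ℕ) : ℕ := Nat.nth Nat.Prime i

section Instance

variable {ℓ : ℕ}

/-- The coefficient of the truth value of a literal. -/
def litSign (a : Fin ℓ × Bool) : ℤ := if a.2 then -1 else 1

/-- The right-hand side of the row of a literal. -/
def litRhs (a : Fin ℓ × Bool) : ℤ := if a.2 then 0 else 1

/-- The coefficients of the common variable in the block of a clause. -/
def clauseA : Matrix (Fin 4) (Fin 1) ℤ := !![1; 1; 1; 0]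

/-- The coefficients of the block variables in the block of a clause. The variables are, for each of
the three literals, the quotient of the common variable by the modulus, and the truth value of the
literal; the last one is a slack variable. -/
noncomputable def clauseB (C : Fin 3 → Fin ℓ × Bool) : Matrix (Fin 4) (Fin 7) ℤ :=
  !![-(modulus (C 0).1 : ℤ), litSign (C 0), 0, 0, 0, 0, 0;
     0, 0, -(modulus (C 1).1 : ℤ), litSign (C 1), 0, 0, 0;
     0, 0, 0, 0, -(modulus (C 2).1 : ℤ), litSign (C 2), 0;
     0, 1, 0, 1, 0, 1, -1]

/-- The right-hand side in the block of a clause. -/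
def clauseRhs (C : Fin 3 → Fin ℓ × Bool) : Fin 4 → ℤ :=
  ![litRhs (C 0), litRhs (C 1), litRhs (C 2), 1]

/-- The upper bounds of the variables in the block of a clause. -/
def clauseUpper (M : ℕ) : Fin 7 → ℤ := ![4 ^ M, 1, 4 ^ M, 1, 4 ^ M, 1, 2]

/-- The 2-stage stochastic ILP of a formula, with `M` additional blocks of zeros. -/
noncomputable def satILP (φ : Formula3 ℓ) (M : ℕ) : TwoStageILP (M + φ.length) 4 1 7 where
  A := Fin.append (fun _ => 0) (fun _ => clauseA)
  B := Fin.append (fun _ => 0) (fun k => clauseB (φ.get k))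
  b p := Fin.append (fun _ => 0) (fun k => clauseRhs (φ.get k)) p.1 p.2
  L := 0
  U := Sum.elim (fun _ => 4 ^ M) fun p => Fin.append (fun _ => 0) (fun _ => clauseUpper M) p.1 p.2
  w := 0

end Instance

/-! ### The encoding of the instance -/

namespace TwoStageILP

variable {n r s t : ℕ}

/-- The encoding of a block. -/
def encodeBlock (I : TwoStageILP n r s t) (i : Fin n) : Word :=
  ((List.finRange r).flatMap fun a =>
      encodeVec (I.A i a) ++ encodeVec (I.B i a) ++ encodeInt (I.b (i, a))) ++
    encodeVec (fun j => I.L (Sum.inr (i, j))) ++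
    encodeVec (fun j => I.U (Sum.inr (i, j))) ++
    encodeVec (fun j => I.w (Sum.inr (i, j)))

lemma constraintMatrix_mulVec (I : TwoStageILP n r s t) (x : Fin s ⊕ Fin n × Fin t → ℤ)
    (i : Fin n) (a : Fin r) :
    (I.constraintMatrix *ᵥ x) (i, a) =
      ∑ j, I.A i a j * x (Sum.inl j) + ∑ j, I.B i a j * x (Sum.inr (i, j)) := by
  simp only [Matrix.mulVec, dotProduct, constraintMatrix, Matrix.of_apply, Fintype.sum_sum_type,
    Fintype.sum_prod_type]
  congr 1
  rw [Finset.sum_eq_single i]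
  · simp
  · intro i' _ h
    simp [h.symm]
  · simp

end TwoStageILP

/-- Positivity matters, since zero has sign bit `false`. Hence `rowHead` can end with the sign, and
the modulus can be written as a natural number. -/
lemma encodeInt_neg_natCast {p : ℕ} (hp : 0 < p) : encodeInt (-(p : ℤ)) = some true :: encodeNat p := by
  have : -(p : ℤ) < 0 := by omega
  simp [encodeInt, hp]

/-- Four rows with `1 + 7` coefficients and a right-hand side, then three vectors of length `7`: `4
* 9 + 3 * 7 = 57`. -/
lemma encodeBlock_satILP_castAdd {ℓ : ℕ} (φ : Formula3 ℓ) (M : ℕ) (i : Fin M) :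
    (satILP φ M).encodeBlock (Fin.castAdd _ i) = zeros 57 := by
  simp [TwoStageILP.encodeBlock, satILP, Fin.append_left, List.finRange_succ, encodeVec, zeros,
    List.replicate_succ]

lemma encodeBlock_satILP_natAdd {ℓ : ℕ} (φ : Formula3 ℓ) (M : ℕ) (k : Fin φ.length) :
    (satILP φ M).encodeBlock (Fin.natAdd M k) = clauseWord M (φ.get k) := by
  have hp : ∀ i, 0 < Nat.nth Nat.Prime i := fun i => (Nat.prime_nth_prime i).pos
  simp [TwoStageILP.encodeBlock, satILP, Fin.append_right, List.finRange_succ, encodeVec, zeros,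
    clauseA, clauseB, clauseRhs, clauseUpper, litSign, litRhs, clauseWord, rowWord, rowHead, rowTail,
    blockTail, lastRow, List.replicate_succ, encodeInt_neg_natCast (hp _)]

lemma encode_satILP {ℓ : ℕ} (φ : Formula3 ℓ) (M : ℕ) : (satILP φ M).encode = outWord φ M := by
  have h : (satILP φ M).encode = encodeNat (M + φ.length) ++ encodeNat 4 ++ encodeNat 1 ++
      encodeNat 7 ++ encodeVec (fun j => (satILP φ M).L (Sum.inl j)) ++
      encodeVec (fun j => (satILP φ M).U (Sum.inl j)) ++
      encodeVec (fun j => (satILP φ M).w (Sum.inl j)) ++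
      (List.finRange (M + φ.length)).flatMap (satILP φ M).encodeBlock := rfl
  have h' : (List.finRange (M + φ.length)).flatMap (satILP φ M).encodeBlock =
      (List.replicate M (zeros 57)).flatten ++ φ.flatMap (clauseWord M) := by
    rw [List.flatMap_def, ← List.ofFn_eq_map, List.ofFn_add]
    simp only [encodeBlock_satILP_natAdd]
    have h₀ : (fun i : Fin M => (satILP φ M).encodeBlock (Fin.castLE (Nat.le_add_right M φ.length) i))
        = fun _ => zeros 57 := funext (encodeBlock_satILP_castAdd φ M)
    rw [h₀]
    simp [List.flatMap_def]
  rw [h, h']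
  simp [outWord, dimWord, satILP, encodeVec]

/-! ### Correctness -/

/-- The rows of the additional blocks read `0 = 0`, and their bounds force their variables to
vanish, so only the common variable and the clause blocks matter. -/
lemma isFeasible_satILP_iff {ℓ : ℕ} (φ : Formula3 ℓ) (M : ℕ)
    (x : Fin 1 ⊕ Fin (M + φ.length) × Fin 7 → ℤ) :
    (satILP φ M).IsFeasible x ↔
      (0 ≤ x (.inl 0) ∧ x (.inl 0) ≤ 4 ^ M) ∧ (∀ i j, x (.inr (Fin.castAdd _ i, j)) = 0) ∧
      ∀ k, (∀ a, clauseA a 0 * x (.inl 0) + ∑ j, clauseB (φ.get k) a j * x (.inr (Fin.natAdd M k, j))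
        = clauseRhs (φ.get k) a) ∧
        ∀ j, 0 ≤ x (.inr (Fin.natAdd M k, j)) ∧ x (.inr (Fin.natAdd M k, j)) ≤ clauseUpper M j := by
  have hm : (satILP φ M).constraintMatrix *ᵥ x = (satILP φ M).b ↔
      ∀ k a, clauseA a 0 * x (.inl 0) + ∑ j, clauseB (φ.get k) a j * x (.inr (Fin.natAdd M k, j))
        = clauseRhs (φ.get k) a := by
    simp only [funext_iff, Prod.forall, TwoStageILP.constraintMatrix_mulVec, Fin.forall_fin_add]
    simp [satILP]
  rw [TwoStageILP.IsFeasible, hm]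
  simp only [Pi.le_def, Sum.forall, Prod.forall, Fin.forall_fin_add]
  simp only [satILP, Pi.zero_apply, Fin.forall_fin_one, Sum.elim_inl, Sum.elim_inr, Fin.append_left,
    Fin.append_right, Fin.isValue]
  constructor
  · rintro ⟨h₁, ⟨h₂, h₃, h₄⟩, h₅, h₆, h₇⟩
    exact ⟨⟨h₂, h₅⟩, fun i j => le_antisymm (h₆ i j) (h₃ i j), fun k => ⟨h₁ k, fun j =>
      ⟨h₄ k j, h₇ k j⟩⟩⟩
  · rintro ⟨⟨h₂, h₅⟩, h₀, h⟩
    exact ⟨fun k => (h k).1, ⟨h₂, fun i j => (h₀ i j).ge, fun k j => ((h k).2 j).1⟩, h₅,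
      fun i j => (h₀ i j).le, fun k j => ((h k).2 j).2⟩

/-- A nonnegative number with prescribed residues modulo the first primes. -/
lemma exists_residues (ℓ : ℕ) (v : ℕ → ℕ) :
    ∃ X : ℕ, X < ∏ i ∈ Finset.range ℓ, modulus i ∧ ∀ i < ℓ, X ≡ v i [MOD modulus i] := by
  have h₁ : ∀ i ∈ Finset.range ℓ, modulus i ≠ 0 := fun i _ => (Nat.prime_nth_prime i).ne_zero
  have h₂ : Set.Pairwise (↑(Finset.range ℓ)) (Function.onFun Nat.Coprime modulus) := by
    intro i _ j _ hij
    refine (Nat.coprime_primes (Nat.prime_nth_prime i) (Nat.prime_nth_prime j)).mpr fun h => hij ?_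
    exact Nat.nth_injective Nat.infinite_setOfPred_prime h
  let X := Nat.chineseRemainderOfFinset v modulus (Finset.range ℓ) h₁ h₂
  exact ⟨X, Nat.chineseRemainderOfFinset_lt_prod v modulus h₁ h₂, fun i hi =>
    X.2 i (Finset.mem_range.mpr hi)⟩

/-- A variable is read as true if `X` has residue `1` modulo its prime, and as false for every other
residue. If `z = 1`, the row of a positive literal gives residue `1`, that of a negative one residue
`0`. -/
theorem satisfiable_of_isFeasible {ℓ : ℕ} (φ : Formula3 ℓ) (M : ℕ)
    {x : Fin 1 ⊕ Fin (M + φ.length) × Fin 7 → ℤ} (hx : (satILP φ M).IsFeasible x) :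
    φ.Satisfiable := by
  obtain ⟨-, -, h⟩ := (isFeasible_satILP_iff φ M x).mp hx
  refine ⟨fun i => decide (x (.inl 0) % modulus i = 1), fun C hC => ?_⟩
  obtain ⟨k, rfl⟩ := List.get_of_mem hC
  obtain ⟨he, hb⟩ := h k
  set C := φ.get k
  have key : ∀ (a : Fin ℓ × Bool) (q z : ℤ), x (.inl 0) + (-(modulus a.1 * q) + litSign a * z) = litRhs a →
      z = 1 → decide (x (.inl 0) % modulus a.1 = 1) = a.2 := by
    rintro ⟨i, b⟩ q z h rfl
    have hp : (1 : ℤ) < modulus i := by exact_mod_cast (Nat.prime_nth_prime i).one_lt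
    cases b
    · have : x (.inl 0) = modulus i * q := by simp [litSign, litRhs] at h; linarith
      simp [this]
    · have : x (.inl 0) = 1 + modulus i * q := by simp [litSign, litRhs] at h; linarith
      rw [this, Int.add_mul_emod_self_left, Int.emod_eq_of_lt (by norm_num) hp]
      rfl
  have e₀ := he 0
  have e₁ := he 1
  have e₂ := he 2
  have e₃ := he 3
  have b₁ := (hb 1).2
  have b₃ := (hb 3).2
  have b₅ := (hb 5).2
  have b₆ := (hb 6).1
  simp [clauseA, clauseB, clauseRhs, Fin.sum_univ_succ, clauseUpper] at e₀ e₁ e₂ e₃ b₁ b₃ b₅ b₆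
  -- The three values are at most `1`, and their sum is `1` plus a nonnegative slack.
  have h₁₃₅ : x (.inr (Fin.natAdd M k, 1)) = 1 ∨ x (.inr (Fin.natAdd M k, 3)) = 1 ∨
      x (.inr (Fin.natAdd M k, 5)) = 1 := by omega
  rcases h₁₃₅ with h | h | h
  · exact ⟨0, key _ _ _ e₀ h⟩
  · exact ⟨1, key _ _ _ e₁ h⟩
  · exact ⟨2, key _ _ _ e₂ h⟩

/-- Take `X` from the Chinese remainder theorem with residues the truth values, its quotients by the
primes, the truth values of the literals, and as slack the number of true literals of the clause
minus one. As `X` is below the product of the primes, it and its quotients respect the bound `4 ^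
M`. -/
theorem exists_isFeasible {ℓ : ℕ} (φ : Formula3 ℓ) {M : ℕ}
    (hM : ∏ i ∈ Finset.range ℓ, modulus i ≤ 4 ^ M) (hφ : φ.Satisfiable) :
    ∃ x, (satILP φ M).IsFeasible x := by
  obtain ⟨v, hv⟩ := hφ
  obtain ⟨X, hX, hXv⟩ := exists_residues ℓ fun i => if h : i < ℓ then (v ⟨i, h⟩).toNat else 0
  let τ : Fin ℓ × Bool → ℤ := fun a => if v a.1 = a.2 then 1 else 0
  have hτ : ∀ a, 0 ≤ τ a ∧ τ a ≤ 1 := fun a => by simp only [τ]; split <;> simp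
  let y : (Fin 3 → Fin ℓ × Bool) → Fin 7 → ℤ := fun C =>
    ![((X / modulus (C 0).1 : ℕ) : ℤ), τ (C 0), ((X / modulus (C 1).1 : ℕ) : ℤ), τ (C 1),
      ((X / modulus (C 2).1 : ℕ) : ℤ), τ (C 2), τ (C 0) + τ (C 1) + τ (C 2) - 1]
  have key : ∀ a : Fin ℓ × Bool, (X : ℤ) + (-((modulus a.1 : ℤ) * ((X / modulus a.1 : ℕ) : ℤ)) +
      litSign a * τ a) = litRhs a := by
    rintro ⟨i, b⟩
    have hp : 1 < modulus i := (Nat.prime_nth_prime i).one_lt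
    have h : X % modulus i = (v i).toNat := by
      have h := hXv i i.2
      simp only [i.2, dite_true] at h
      exact Eq.trans h (Nat.mod_eq_of_lt ((Bool.toNat_le _).trans_lt hp))
    have h' : (modulus i : ℤ) * ((X / modulus i : ℕ) : ℤ) + (v i).toNat = X := by
      rw [← h]
      exact_mod_cast Nat.div_add_mod X (modulus i)
    rw [← h']
    cases b <;> cases hvi : v i <;> simp [τ, litSign, litRhs, hvi]
    ring
  have hXM : (X : ℤ) ≤ 4 ^ M := by exact_mod_cast hX.le.trans hM
  have hdiv : ∀ p : ℕ, ((X / p : ℕ) : ℤ) ≤ 4 ^ M := fun p =>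
    le_trans (by exact_mod_cast Nat.div_le_self X p) hXM
  refine ⟨Sum.elim (fun _ => X) fun p => Fin.append (fun _ => 0) (fun k => y (φ.get k)) p.1 p.2,
    (isFeasible_satILP_iff φ M _).mpr ⟨⟨by simp, hXM⟩, by simp, fun k => ⟨fun a => ?_, fun j => ?_⟩⟩⟩
  · simp only [Sum.elim_inl, Sum.elim_inr, Fin.append_right]
    generalize φ.get k = C
    have h₀ := key (C 0)
    have h₁ := key (C 1)
    have h₂ := key (C 2)
    fin_cases a
    · simpa [clauseA, clauseB, clauseRhs, Fin.sum_univ_succ, y] using h₀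
    · simpa [clauseA, clauseB, clauseRhs, Fin.sum_univ_succ, y] using h₁
    · simpa [clauseA, clauseB, clauseRhs, Fin.sum_univ_succ, y] using h₂
    · simp [clauseA, clauseB, clauseRhs, Fin.sum_univ_succ, y]
      ring
  · simp only [Sum.elim_inr, Fin.append_right]
    have hsum : 0 ≤ τ ((φ.get k) 0) + τ ((φ.get k) 1) + τ ((φ.get k) 2) - 1 := by
      obtain ⟨i, hi⟩ := hv _ (List.get_mem φ k)
      have h₀ := (hτ ((φ.get k) 0)).1
      have h₁ := (hτ ((φ.get k) 1)).1
      have h₂ := (hτ ((φ.get k) 2)).1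
      have h : τ ((φ.get k) i) = 1 := if_pos hi
      fin_cases i <;> simp only [Fin.zero_eta, Fin.mk_one, Fin.reduceFinMk] at h <;> omega
    generalize φ.get k = C at hsum ⊢
    have h₀ := hτ (C 0)
    have h₁ := hτ (C 1)
    have h₂ := hτ (C 2)
    fin_cases j
    · exact ⟨Int.natCast_nonneg _, hdiv _⟩
    · exact h₀
    · exact ⟨Int.natCast_nonneg _, hdiv _⟩
    · exact h₁
    · exact ⟨Int.natCast_nonneg _, hdiv _⟩
    · exact h₂
    · refine ⟨hsum, ?_⟩
      change τ (C 0) + τ (C 1) + τ (C 2) - 1 ≤ 2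
      linarith [h₀.2, h₁.2, h₂.2]

/-! ### The parameters -/

/-- It suffices that at least `i + 1` primes are at most `n`, which follows from Chebyshev's lower
bound. A quadratic estimate is enough, as the entries may be of order `N ^ 2 log N`. -/
lemma nth_prime_le (i : ℕ) : Nat.nth Nat.Prime i ≤ 4 * (i + 2) ^ 2 := by
  set n := 4 * (i + 2) ^ 2 with hn
  have hx : (0 : ℝ) < (i : ℝ) + 2 := by positivity
  have hnr : (n : ℝ) = 4 * ((i : ℝ) + 2) ^ 2 := by simp [hn]
  have hlx : Real.log ((i : ℝ) + 2) ≤ (i : ℝ) + 1 := by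
    have := Real.log_le_sub_one_of_pos hx
    linarith
  have h2 := Real.log_two_gt_d9
  have h2' := Real.log_two_lt_d9
  have hi : (0 : ℝ) ≤ i := Nat.cast_nonneg i
  have h4 : Real.log 4 = 2 * Real.log 2 := by
    rw [show (4 : ℝ) = 2 ^ 2 by norm_num, Real.log_pow]
    norm_num
  have hlog : Real.log n = 2 * Real.log 2 + 2 * Real.log ((i : ℝ) + 2) := by
    rw [hnr, Real.log_mul (by norm_num) (by positivity), Real.log_pow, h4]
    norm_num
  have hlog' : Real.log (n + 1) ≤ 3 * Real.log 2 + 2 * Real.log ((i : ℝ) + 2) := by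
    have h8 : (n : ℝ) + 1 ≤ 8 * ((i : ℝ) + 2) ^ 2 := by rw [hnr]; nlinarith
    refine (Real.log_le_log (by positivity) h8).trans_eq ?_
    rw [Real.log_mul (by norm_num) (by positivity), Real.log_pow,
      show (8 : ℝ) = 2 ^ 3 by norm_num, Real.log_pow]
    norm_num
  have hpos : 0 < Real.log n := by
    rw [hlog]
    have : 0 ≤ Real.log ((i : ℝ) + 2) := Real.log_nonneg (by linarith)
    linarith
  have hpi : ((i : ℝ) + 1) ≤ n.primeCounting := by
    -- Once the denominator is cleared, the main terms are `4 log 2 · (i + 2) ^ 2` against `2 (i +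
    -- 1) log (i + 2) ≤ 2 (i + 1) ^ 2`, and `4 log 2 > 2`.
    refine le_trans ?_ (Chebyshev.pi_ge n)
    rw [le_div_iff₀ hpos, hnr]
    rw [hnr] at hlog hlog'
    nlinarith
  have h : i < Nat.count Nat.Prime (n + 1) := by
    have : i + 1 ≤ n.primeCounting := by exact_mod_cast hpi
    exact this
  exact Nat.lt_succ_iff.mp (Nat.nth_lt_of_lt_count h)

/-- Each of the `ℓ ≤ N` factors is at most `(2 N) ^ 2 ≤ 4 ^ N`. Hence `M = N ^ 2` serves both as
exponent of the upper bounds and as number of additional blocks. -/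
lemma prod_modulus_le {ℓ N : ℕ} (hN : ℓ + 2 ≤ N) :
    ∏ i ∈ Finset.range ℓ, modulus i ≤ 4 ^ N ^ 2 := by
  have h₁ : ∀ i ∈ Finset.range ℓ, modulus i ≤ (2 * N) ^ 2 := fun i hi => by
    have hi := Finset.mem_range.mp hi
    calc modulus i ≤ 4 * (i + 2) ^ 2 := nth_prime_le i
      _ = (2 * (i + 2)) ^ 2 := by ring
      _ ≤ (2 * N) ^ 2 := by gcongr; omega
  have h₂ : 2 * N ≤ 2 ^ N := by
    obtain ⟨k, rfl⟩ : ∃ k, N = k + 1 := ⟨N - 1, by omega⟩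
    have := Nat.lt_two_pow_self (n := k)
    rw [pow_succ]
    omega
  calc ∏ i ∈ Finset.range ℓ, modulus i ≤ ∏ _i ∈ Finset.range ℓ, (2 * N) ^ 2 :=
        Finset.prod_le_prod' h₁
    _ = ((2 * N) ^ 2) ^ ℓ := by simp
    _ ≤ ((2 ^ N) ^ 2) ^ ℓ := by gcongr
    _ ≤ ((2 ^ N) ^ 2) ^ N := Nat.pow_le_pow_right (by positivity) (by omega)
    _ = 4 ^ N ^ 2 := by
      rw [show 4 = 2 ^ 2 by rfl, ← pow_mul, ← pow_mul, ← pow_mul]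
      congr 1
      ring

lemma infNorm_le {ι : Type*} [Fintype ι] {v : ι → ℤ} {c : ℕ} (h : ∀ i, (v i).natAbs ≤ c) :
    infNorm v ≤ c :=
  Finset.sup_le fun i _ => h i

/-- The parameter of the restrictions is `N`, not the number of variables; the summand `2` in `N`
ensures `2 ≤ N`. The number of blocks `N ^ 2 + m` lies between `N ^ 2` and `2 N ^ 2`. -/
theorem restricted_satILP {ℓ : ℕ} (φ : Formula3 ℓ) {N : ℕ} (hN : N = ℓ + φ.length + 2) :
    (satILP φ (N ^ 2)).Restricted 8 N where
  two_le := by omega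
  sq_le := by nlinarith [φ.length.zero_le, sq_nonneg N]
  le_sq := by nlinarith [φ.length.zero_le, ℓ.zero_le]
  norm_b := by
    refine infNorm_le ?_
    simp only [Prod.forall, Fin.forall_fin_add, satILP, Fin.append_left, Fin.append_right]
    refine ⟨by simp, fun k a => ?_⟩
    have h : ∀ a : Fin ℓ × Bool, (litRhs a).natAbs ≤ 8 := fun a => by
      unfold litRhs; split <;> simp
    fin_cases a
    · exact h _
    · exact h _
    · exact h _
    · simp [clauseRhs]
  norm_L := infNorm_le (by simp [satILP])
  norm_w := infNorm_le (by simp [satILP])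
  delta := by
    have h : (satILP φ (N ^ 2)).Delta ≤ 4 * N ^ 2 := by
      have h1 : 1 ≤ 4 * N ^ 2 := by nlinarith
      have hp : ∀ i : Fin ℓ, modulus i ≤ 4 * N ^ 2 := fun i =>
        (nth_prime_le i).trans (by have := i.2; gcongr; omega)
      have hs : ∀ a : Fin ℓ × Bool, (litSign a).natAbs ≤ 4 * N ^ 2 := fun a => by
        unfold litSign; split <;> simpa using h1
      refine infNorm_le fun ⟨⟨i, a⟩, c⟩ => ?_
      rcases c with j | ⟨i', j⟩
      · change ((satILP φ (N ^ 2)).A i a j).natAbs ≤ _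
        induction i using Fin.addCases with
        | left i => simp [satILP]
        | right i =>
          simp only [satILP, Fin.append_right]
          fin_cases a <;> fin_cases j <;> simp [clauseA] <;> omega
      · change (if i = i' then (satILP φ (N ^ 2)).B i a j else 0).natAbs ≤ _
        split
        · induction i using Fin.addCases with
          | left i => simp [satILP]
          | right i =>
            simp only [satILP, Fin.append_right]
            fin_cases a <;> fin_cases j <;> simp [clauseB, hp, hs] <;> omega
        · simp
    -- This turns the bound `4 N ^ 2` into `8 N ^ 2 log N`, whence the constant `8`.
    have hl : (1 / 2 : ℝ) ≤ Real.log N := by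
      have h2 : Real.log 2 ≤ Real.log N :=
        Real.log_le_log (by norm_num) (by exact_mod_cast (by omega : 2 ≤ N))
      linarith [Real.log_two_gt_d9]
    calc ((satILP φ (N ^ 2)).Delta : ℝ) ≤ ((4 * N ^ 2 : ℕ) : ℝ) := by exact_mod_cast h
      _ = 8 * ((N : ℝ) ^ 2 * (1 / 2)) := by push_cast; ring
      _ ≤ ((8 : ℕ) : ℝ) * ((N : ℝ) ^ 2 * Real.log N) := by
        push_cast
        gcongr
  norm_U := by
    have h1 : (1 : ℕ) ≤ 4 ^ (8 * N ^ 2) := Nat.one_le_pow _ _ (by norm_num)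
    have h2 : (2 : ℕ) ≤ 4 ^ (8 * N ^ 2) := by
      calc 2 ≤ 4 ^ 1 := by norm_num
        _ ≤ 4 ^ (8 * N ^ 2) := by gcongr <;> nlinarith
    have hM : ((4 : ℤ) ^ N ^ 2).natAbs ≤ 4 ^ (8 * N ^ 2) := by
      rw [Int.natAbs_pow]
      exact Nat.pow_le_pow_right (by norm_num) (by omega)
    refine infNorm_le ?_
    simp only [Sum.forall, Prod.forall, Fin.forall_fin_add, satILP, Sum.elim_inl, Sum.elim_inr,
      Fin.append_left, Fin.append_right]
    refine ⟨fun _ => hM, by simp, fun k j => ?_⟩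
    fin_cases j
    · exact hM
    · exact h1
    · exact hM
    · exact h1
    · exact hM
    · exact h1
    · exact h2

/-! ### The running time of the reduction -/

/-- `f` is bounded by a polynomial. -/
def PolyBounded (f : ℕ → ℕ) : Prop := ∃ C k : ℕ, ∀ n, f n ≤ C * (n + 1) ^ k

namespace PolyBounded

variable {f g : ℕ → ℕ}

lemma const (c : ℕ) : PolyBounded fun _ => c := ⟨c, 0, by simp⟩

lemma id : PolyBounded fun n => n := ⟨1, 1, by simp⟩

lemma add (hf : PolyBounded f) (hg : PolyBounded g) : PolyBounded fun n => f n + g n := by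
  obtain ⟨C, k, hf⟩ := hf
  obtain ⟨D, j, hg⟩ := hg
  refine ⟨C + D, k + j, fun n => ?_⟩
  have h₁ : (n + 1) ^ k ≤ (n + 1) ^ (k + j) := Nat.pow_le_pow_right (by omega) (by omega)
  have h₂ : (n + 1) ^ j ≤ (n + 1) ^ (k + j) := Nat.pow_le_pow_right (by omega) (by omega)
  rw [add_mul]
  exact add_le_add ((hf n).trans (Nat.mul_le_mul_left _ h₁))
    ((hg n).trans (Nat.mul_le_mul_left _ h₂))

lemma mul (hf : PolyBounded f) (hg : PolyBounded g) : PolyBounded fun n => f n * g n := by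
  obtain ⟨C, k, hf⟩ := hf
  obtain ⟨D, j, hg⟩ := hg
  refine ⟨C * D, k + j, fun n => (Nat.mul_le_mul (hf n) (hg n)).trans_eq ?_⟩
  ring

lemma pow (hf : PolyBounded f) (j : ℕ) : PolyBounded fun n => f n ^ j := by
  induction j with
  | zero => simpa using const 1
  | succ j ih => simpa only [pow_succ] using ih.mul hf

/-- Powers of `n` are negligible against `r ^ n` for `r = 2 ^ ε > 1`; a large enough constant covers
the small `n` as well. -/
lemma exists_le_rpow (hf : PolyBounded f) {ε : ℝ} (hε : 0 < ε) :
    ∃ D : ℝ, 0 < D ∧ ∀ n : ℕ, (f n : ℝ) ≤ D * (2 : ℝ) ^ (ε * n) := by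
  obtain ⟨C, k, hf⟩ := hf
  have hr : 1 < (2 : ℝ) ^ ε := Real.one_lt_rpow (by norm_num) hε
  obtain ⟨D, hD, h⟩ := Asymptotics.bound_of_isBigO_nat_atTop
    (isLittleO_pow_const_const_pow_of_one_lt (R := ℝ) k hr).isBigO
  refine ⟨(C + 1) * (D * (2 : ℝ) ^ ε), by positivity, fun n => ?_⟩
  -- The polynomial bound is in `n + 1`, which costs the extra factor `2 ^ ε` in the constant.
  have hn := h (x := n + 1) (by positivity)
  rw [Real.norm_of_nonneg (by positivity), Real.norm_of_nonneg (by positivity)] at hn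
  calc (f n : ℝ) ≤ C * ((n + 1 : ℕ) : ℝ) ^ k := by exact_mod_cast hf n
    _ ≤ (C + 1) * (D * ((2 : ℝ) ^ ε) ^ (n + 1)) := by gcongr; linarith
    _ = (C + 1) * (D * (2 : ℝ) ^ ε) * (2 : ℝ) ^ (ε * n) := by
      rw [Real.rpow_mul (by norm_num), Real.rpow_natCast, pow_succ]
      ring

end PolyBounded

lemma length_encodeNat_le (k : ℕ) : (encodeNat k).length ≤ k + 1 := by
  simpa [encodeNat] using k.length_bits_le

lemma length_encode_le {ℓ N : ℕ} (φ : Formula3 ℓ) (hN : N = ℓ + φ.length + 2) :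
    φ.encode.length ≤ 4 * N ^ 2 := by
  have h : ∀ a : Fin ℓ × Bool, (Formula3.encodeLiteral a).length ≤ N := fun a => by
    have h₁ := length_encodeNat_le a.1
    have h₂ := a.1.2
    rw [Formula3.encodeLiteral, List.length_cons]
    omega
  have h' : ∀ ψ : Formula3 ℓ, (ψ.flatMap fun C => Formula3.encodeLiteral (C 0) ++
      Formula3.encodeLiteral (C 1) ++ Formula3.encodeLiteral (C 2)).length ≤ ψ.length * (3 * N) := by
    intro ψ
    induction ψ with
    | nil => simp
    | cons C ψ ih =>
      have h₀ := h (C 0)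
      have h₁ := h (C 1)
      have h₂ := h (C 2)
      rw [List.flatMap_cons, List.length_append, List.length_cons, add_mul]
      simp only [List.length_append] at ih ⊢
      omega
  have h₁ := length_encodeNat_le ℓ
  have h₂ := length_encodeNat_le φ.length
  have h₃ := h' φ
  have h₄ : φ.length * (3 * N) ≤ N * (3 * N) := Nat.mul_le_mul_right _ (by omega)
  rw [Formula3.encode, List.length_append, List.length_append]
  nlinarith

namespace Prog

lemma get_inp (x : Word) : ({ inp := x } : St).get = only .inp x := by
  funext j
  cases j <;> simp [only]

lemma get_out (x : Word) : ({ out := x } : St).get = only .out x := by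
  funext j
  cases j <;> simp [only]

lemma sum_length_only {K : Type} [DecidableEq K] [Fintype K] (k : K) (x : Word) :
    ∑ j, (only k x j).length = x.length := by
  rw [Finset.sum_eq_single k]
  · simp [only]
  · intro j _ hj
    simp [only, hj]
  · simp

/-- The running time of the reduction, for `N = ℓ + m + 2`. -/
def totalTime (N : ℕ) : ℕ := reductionTime N (4 * N ^ 2)

/-- A bound for the length of the output of the reduction. -/
def outBound (N : ℕ) : ℕ := 4 * N ^ 2 + reduction.weight * (totalTime N + 1)

lemma polyBounded_totalTime : PolyBounded totalTime := by
  have c := PolyBounded.const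
  have i := PolyBounded.id
  have hP : PolyBounded fun N => 4 * N ^ 2 := (c 4).mul (i.pow 2)
  have hN : PolyBounded fun N => N + 1 := i.add (c 1)
  have hP1 := hP.add (c 1)
  have hlit : PolyBounded fun N => litTime N (4 * N ^ 2) :=
    ((c 2).mul (hN.pow 2)).add (((hN.mul (((c 11).mul (hP1.pow 4)).add (c 1))).add (c 1)).add
      ((c 2).mul (hP1.pow 2)))
  have h2 : PolyBounded fun N => 2 * N ^ 2 + 2 := ((c 2).mul (i.pow 2)).add (c 2)
  exact ((c 20).mul (hN.pow 2)).add (((c 2).mul ((((i.pow 2).add i).add (c 1)).pow 2)).add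
    (h2.add (h2.add (((i.mul ((((c 3).mul hlit).add ((c 3).mul h2)).add (c 1))).add (c 1)).add
      ((i.pow 2).add (c 1))))))

lemma polyBounded_outBound : PolyBounded outBound :=
  ((PolyBounded.const 4).mul (PolyBounded.id.pow 2)).add
    ((PolyBounded.const _).mul (polyBounded_totalTime.add (PolyBounded.const 1)))

lemma exec_reduction {ℓ N : ℕ} (φ : Formula3 ℓ) (hN : N = ℓ + φ.length + 2) :
    Exec reduction (only .inp φ.encode) (only .out (satILP φ (N ^ 2)).encode.reverse)
      (totalTime N) := by
  rw [encode_satILP, ← get_inp, ← get_out]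
  refine run_reduction φ hN fun i hi => (nth_prime_le i).trans ?_
  gcongr
  omega

/-- No letters of the instance are counted: the program writes boundedly many between two loop
tests, so its running time bounds its output. -/
lemma size_satILP_le {ℓ N : ℕ} (φ : Formula3 ℓ) (hN : N = ℓ + φ.length + 2) :
    (satILP φ (N ^ 2)).size ≤ outBound N := by
  have h := (exec_reduction φ hN).sum_length_le
  rw [sum_length_only, sum_length_only, List.length_reverse] at h
  exact h.trans (Nat.add_le_add_right (length_encode_le φ hN) _)

end Prog

/-! ### From feasibility algorithms to 3-SAT algorithms -/

lemma OutputsWithin.mono {M : Algorithm} {x y : Word} {T T' : ℝ} (h : OutputsWithin M x y T)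
    (hT : T ≤ T') : OutputsWithin M x y T' := by
  obtain ⟨k, hk, h⟩ := h
  exact ⟨k, hk.trans hT, h⟩

/-- An algorithm for feasibility of the restricted instances gives one for 3-SAT. -/
theorem exists_algorithm_sat {δ : ℝ} (hδ : 0 < δ) (M : Algorithm) (C : ℝ) (k : ℕ)
    (hM : ∀ (ℓ n : ℕ) (I : TwoStageILP n 4 1 7), I.Restricted 8 ℓ →
      DecidesWithin M I.encode (∃ x, I.IsFeasible x)
        (C * (I.size : ℝ) ^ k * (2 : ℝ) ^ (δ / 4 * Real.sqrt n))) :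
    ∃ (M' : Algorithm) (C' : ℝ), ∀ (ℓ : ℕ) (φ : Formula3 ℓ),
      DecidesWithin M' φ.encode φ.Satisfiable
        (C' * (2 : ℝ) ^ (δ * ((ℓ : ℝ) + (φ.length : ℝ)))) := by
  -- Half of the exponent `δ N` pays for the polynomial factors, the other half for the algorithm
  -- `M`.
  obtain ⟨D, hD, hF⟩ := ((Prog.polyBounded_totalTime.add Prog.polyBounded_outBound).add
    ((PolyBounded.const 2).add (Prog.polyBounded_outBound.pow k))).exists_le_rpow (half_pos hδ)
  -- The absolute value is taken because `C` may be negative; the factor `2 ^ (δ * 2)` accounts for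
  -- the `2` in `N = ℓ + m + 2`.
  refine ⟨Prog.compose Prog.reduction .inp .out M, (1 + |C|) * D * (2 : ℝ) ^ (δ * 2),
    fun ℓ φ => ?_⟩
  obtain ⟨N, hN⟩ : ∃ N, N = ℓ + φ.length + 2 := ⟨_, rfl⟩
  obtain ⟨y, hy, hyP⟩ := hM N _ _ (restricted_satILP φ hN)
  refine ⟨y, (Prog.outputsWithin_compose (Prog.exec_reduction φ hN) hy).mono ?_, hyP.trans
    ⟨fun ⟨x, hx⟩ => satisfiable_of_isFeasible φ _ hx, fun h =>
      exists_isFeasible φ (prod_modulus_le (by omega)) h⟩⟩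
  have hsize := Prog.size_satILP_le φ hN
  have hF := hF N
  clear hyP hy hM
  change (Prog.totalTime N : ℝ) + ((satILP φ (N ^ 2)).size : ℝ) + 2 + _ ≤ _
  generalize (satILP φ (N ^ 2)).size = S at hsize ⊢
  generalize Prog.totalTime N = a at hF ⊢
  generalize Prog.outBound N = o at hF hsize
  have hS : (S : ℝ) ≤ o := by exact_mod_cast hsize
  -- There are `N ^ 2 + m ≤ (2 N) ^ 2` blocks; this is where the quarter of `δ` comes from.
  have hsqrt : δ / 4 * √((N ^ 2 + φ.length : ℕ) : ℝ) ≤ δ / 2 * N := by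
    have h : √((N ^ 2 + φ.length : ℕ) : ℝ) ≤ 2 * N := by
      rw [Real.sqrt_le_left (by positivity)]
      have : N ^ 2 + φ.length ≤ (2 * N) ^ 2 := by nlinarith
      exact_mod_cast this
    calc δ / 4 * √((N ^ 2 + φ.length : ℕ) : ℝ) ≤ δ / 4 * (2 * N) := by gcongr
      _ = δ / 2 * N := by ring
  set E : ℝ := (2 : ℝ) ^ (δ / 2 * N) with hE
  have hE1 : 1 ≤ E := Real.one_le_rpow (by norm_num) (by positivity)
  have hEE : (2 : ℝ) ^ (δ / 4 * √((N ^ 2 + φ.length : ℕ) : ℝ)) ≤ E :=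
    Real.rpow_le_rpow_of_exponent_le (by norm_num) hsqrt
  push_cast at hF
  have h₁ : C * (S : ℝ) ^ k *
      (2 : ℝ) ^ (δ / 4 * √((N ^ 2 + φ.length : ℕ) : ℝ)) ≤ |C| * o ^ k * E := by
    gcongr
    exact le_abs_self C
  have h₂ : (a : ℝ) + o + 2 ≤ (a + o + 2) * E := le_mul_of_one_le_right (by positivity) hE1
  calc (a : ℝ) + S + 2 + _
      ≤ a + o + 2 + |C| * o ^ k * E := by gcongr
    _ ≤ (a + o + 2) * E + |C| * o ^ k * E := by gcongr
    _ ≤ (1 + |C|) * (a + o + (2 + o ^ k)) * E := by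
      have : 0 ≤ |C| * ((a : ℝ) + o + 2) + o ^ k := by positivity
      nlinarith
    _ ≤ (1 + |C|) * (D * E) * E := by gcongr
    _ = (1 + |C|) * D * (E * E) := by ring
    _ = (1 + |C|) * D * (2 : ℝ) ^ (δ * 2) * (2 : ℝ) ^ (δ * ((ℓ : ℝ) + (φ.length : ℝ))) := by
      rw [hE, ← Real.rpow_add (by norm_num), mul_assoc _ ((2 : ℝ) ^ (δ * 2)),
        ← Real.rpow_add (by norm_num), hN]
      congr 2
      push_cast
      ring

/-- The first output letter of a solver already tells whether a feasible vector exists, so hardness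
of feasibility implies hardness of optimization. -/
lemma TwoStageILP.SolvedWithin.decidesWithin {n r s t : ℕ} {I : TwoStageILP n r s t} {M : Algorithm}
    {T : ℝ} (h : I.SolvedWithin M T) : DecidesWithin M I.encode (∃ x, I.IsFeasible x) T := by
  rcases h with ⟨h, hM⟩ | ⟨x, hx, hM⟩
  · exact ⟨_, hM, by simp [h]⟩
  · exact ⟨_, hM, by simpa using ⟨x, hx.1⟩⟩

/-- Assuming the Exponential Time Hypothesis, there is `δ > 0` such that no algorithm solves all
2-stage stochastic ILPs with `n` blocks in time `2 ^ (δ √n) · |I| ^ O(1)`; and even on instances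
with constant `r`, `s`, `t` that obey the parameter restrictions, no algorithm decides feasibility
in such a time. -/
theorem corollaryt (hETH : ExponentialTimeHypothesis) :
    ∃ δ : ℝ, 0 < δ ∧
      (¬ ∃ (M : Algorithm) (C : ℝ) (k : ℕ),
        ∀ (n r s t : ℕ) (I : TwoStageILP n r s t),
          I.SolvedWithin M (C * (I.size : ℝ) ^ k * (2 : ℝ) ^ (δ * Real.sqrt n))) ∧
      ∃ r s t c : ℕ, ¬ ∃ (M : Algorithm) (C : ℝ) (k : ℕ),
        ∀ (ℓ n : ℕ) (I : TwoStageILP n r s t), I.Restricted c ℓ →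
          DecidesWithin M I.encode (∃ x, I.IsFeasible x)
            (C * (I.size : ℝ) ^ k * (2 : ℝ) ^ (δ * Real.sqrt n)) := by
  obtain ⟨δ, hδ, h⟩ := hETH
  -- A clause block has three literal rows and one clause row, one common variable, and three
  -- quotients, three truth values and a slack; `8` is the constant of `restricted_satILP`.
  refine ⟨δ / 4, by positivity, ?_, 4, 1, 7, 8, ?_⟩
  · rintro ⟨M, C, k, hM⟩
    exact h (exists_algorithm_sat hδ M C k fun _ n I _ => (hM n 4 1 7 I).decidesWithin)
  · rintro ⟨M, C, k, hM⟩
    exact h (exists_algorithm_sat hδ M C k hM)
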